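/- \textbf{Definitions.} A \emph{Hilbert category} is an additive subcategory $\mathcal C$ (with objects possibly carrying extra structure) of the category of complex Hilbert spaces and bounded linear maps such that for every morphism $f:H\to H'$ of $\mathcal C$ the inclusion $\ker f\subset H$ and the adjoint $f^*:H'\to H$ belong to $\mathcal C$. Its \emph{extended abelian category} $\mathcal E(\mathcal C)$ has as objects the morphisms $(\alpha:A'\to A)$ of $\mathcal C$. A morphism $(\alpha:A'\to A)\to(\beta:B'\to B)$ is an equivalence class of morphisms $f:A\to B$ of $\mathcal C$ for which there is a morphism $g:A'\to B'$ of $\mathcal C$ with $f\alpha=\beta g$, where $f\sim f'$ if $f-f'=\beta F$ for some morphism $F:A\to B'$ of $\mathcal C$. The embedding $\mathcal C\to\mathcal E(\mathcal C)$ is $A\mapsto(0\to A)$. The \emph{extended homology} $\mathcal H_n(C)$ of a chain complex $(C,d)$ in $\mathcal C$ is its homology in $\mathcal E(\mathcal C)$, that is, $\mathcal H_n(C)=(d:C_{n+1}\to Z_n)$ with $Z_n=\ker(d:C_n\to C_{n-1})$. Let $\mathcal C,\mathcal C',\mathcal C''$ be Hilbert categories and let $\hat\otimes:\mathcal C\times\mathcal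 C'\to\mathcal C''$ be a covariant functor of two variables such that the Hilbert space underlying $H\hat\otimes H'$ is the Hilbert space tensor product of $H$ and $H'$ (the completion of the algebraic tensor product for $\langle v\otimes w,v'\otimes w'\rangle=\langle v,v'\rangle\langle w,w'\rangle$) and $f\hat\otimes f'$ is the tensor product of the bounded linear maps $f$ and $f'$. Every object of an extended category is isomorphic to one given by an injective morphism (restrict $\alpha$ to $(\ker\alpha)^\perp$). For $\mathcal X=(\alpha:A'\to A)\in\mathcal E(\mathcal C)$ and $\mathcal Y=(\beta:B'\to B)\in\mathcal E(\mathcal C')$, represented with $\alpha,\beta$ injective, define in $\mathcal E(\mathcal C'')$ the \emph{tensor product} and the \emph{periodic product} $$\mathcal X\hat\otimes\mathcal Y=\bigl((\alpha\hat\otimes1,\,1\hat\otimes\beta):(A'\hat\otimes B)\oplus(A\hat\otimes B')\to A\hat\otimes B\bigr),\qquad \mathcal X*\mathcal Y=\left(\begin{pmatrix}-1\hat\otimes\beta\\ \alpha\hat\otimes1\end{pmatrix}:A'\hat\otimes B'\to Z\right),$$ where $Z=\ker\bigl[(\alpha\hat\otimes1,\,1\hat\otimes\beta):(A'\hat\otimes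 B)\oplus(A\hat\otimes B')\to A\hat\otimes B\bigr]$. \textbf{Theorem (Künneth formula).} Let $(C,d)$ be a chain complex in $\mathcal C$ and $(C',d)$ a chain complex in $\mathcal C'$, both graded by the non-negative integers and of finite length, and let $C\hat\otimes C'$ be their tensor product, a chain complex in $\mathcal C''$ with differential $d(x\otimes y)=dx\otimes y+(-1)^{\deg x}x\otimes dy$. Then for every $n\ge0$ there is an isomorphism in $\mathcal E(\mathcal C'')$ $$\mathcal H_n(C\hat\otimes C')\;\cong\;\bigoplus_{i+j=n}\mathcal H_i(C)\hat\otimes\mathcal H_j(C')\;\oplus\;\bigoplus_{i+j=n-1}\mathcal H_i(C)*\mathcal H_j(C').$$ -/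

import Mathlib

open CategoryTheory Limits
open scoped TensorProduct ZeroObject

universe w v u v₁ u₁ v₂ u₂ v₃ u₃

noncomputable section

attribute [-instance] CategoryTheory.catToReflQuiver

/-! ### The category of Hilbert spaces and bounded linear maps -/

/-- A complex Hilbert space. -/
structure HilbertSpaceCat : Type (w + 1) where
  carrier : Type w
  [normedAddCommGroup : NormedAddCommGroup carrier]
  [innerProductSpace : InnerProductSpace ℂ carrier]
  [completeSpace : CompleteSpace carrier]

namespace HilbertSpaceCat

instance : CoeSort HilbertSpaceCat.{w} (Type w) := ⟨HilbertSpaceCat.carrier⟩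

attribute [instance] normedAddCommGroup innerProductSpace completeSpace

/-- Morphisms of Hilbert spaces are the bounded linear maps. -/
instance : Category HilbertSpaceCat.{w} where
  Hom X Y := X →L[ℂ] Y
  id X := ContinuousLinearMap.id ℂ X
  comp f g := ContinuousLinearMap.comp g f

/-- The bounded linear map underlying a morphism. -/
def clm {X Y : HilbertSpaceCat.{w}} (f : X ⟶ Y) : X →L[ℂ] Y := f

instance : Preadditive HilbertSpaceCat.{w} where
  homGroup X Y := inferInstanceAs (AddCommGroup (X →L[ℂ] Y))
  add_comp _ _ _ f f' g := ContinuousLinearMap.comp_add g f f'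
  comp_add _ _ _ f g g' := ContinuousLinearMap.add_comp g g' f

end HilbertSpaceCat

open HilbertSpaceCat

/-! ### Hilbert categories -/

/-- A Hilbert category: an additive subcategory of the category of Hilbert spaces and bounded linear
maps, closed under adjoints of morphisms and containing the inclusion of the kernel of each of its
morphisms. The subcategory is given by its (faithful, additive) inclusion functor, so that an object
may also be a Hilbert space with further structure, for example a unitary group action. -/
class HilbertCategory (C : Type u) [Category.{v} C] extends Preadditive C where
  [hasFiniteBiproducts : HasFiniteBiproducts C]
  /-- the inclusion into the category of Hilbert spaces -/
  incl : C ⥤ HilbertSpaceCat.{v}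
  [faithful : incl.Faithful]
  [additive : incl.Additive]
  exists_kernel {X Y : C} (f : X ⟶ Y) : ∃ (K : C) (i : K ⟶ X),
    Isometry (clm (incl.map i)) ∧ (clm (incl.map i)).range = (clm (incl.map f)).ker
  exists_adjoint {X Y : C} (f : X ⟶ Y) : ∃ g : Y ⟶ X,
    clm (incl.map g) = ContinuousLinearMap.adjoint (clm (incl.map f))

namespace HilbertCategory

attribute [instance] hasFiniteBiproducts faithful additive

variable {C : Type u} [Category.{v} C] [HilbertCategory C]

instance : HasZeroObject C := hasZeroObject_of_hasFiniteBiproducts C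

variable (C) in
/-- The inclusion functor of a Hilbert category, with the category explicit. -/
abbrev inclusion : C ⥤ HilbertSpaceCat.{v} := incl

/-- The Hilbert space underlying an object of a Hilbert category. -/
abbrev space (X : C) : HilbertSpaceCat.{v} := (inclusion C).obj X

/-- The bounded linear toCLM underlying a morphism of a Hilbert category. -/
def toCLM {X Y : C} (f : X ⟶ Y) : space X →L[ℂ] space Y := clm ((inclusion C).map f)

theorem toCLM_injective {X Y : C} {f g : X ⟶ Y} (h : toCLM f = toCLM g) : f = g :=
  (inclusion C).map_injective h

theorem toCLM_comp {X Y Z : C} (f : X ⟶ Y) (g : Y ⟶ Z) : toCLM (f ≫ g) = (toCLM g).comp (toCLM f) :=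
  (inclusion C).map_comp f g

theorem toCLM_id (X : C) : toCLM (𝟙 X) = ContinuousLinearMap.id ℂ (space X) :=
  (inclusion C).map_id X

theorem toCLM_zero (X Y : C) : toCLM (0 : X ⟶ Y) = 0 := (inclusion C).map_zero X Y

/-- The adjoint of a morphism of a Hilbert category. -/
def adj {X Y : C} (f : X ⟶ Y) : Y ⟶ X := (exists_adjoint f).choose

theorem toCLM_adj {X Y : C} (f : X ⟶ Y) : toCLM (adj f) = ContinuousLinearMap.adjoint (toCLM f) :=
  (exists_adjoint f).choose_spec

/-- The inclusion of the Hilbert space kernel of `f` is a kernel of `f` in the categorical sense. -/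
instance : HasKernels C where
  has_limit {X Y} f := by
    obtain ⟨K, i, hi, hr⟩ := exists_kernel f
    change Isometry (toCLM i) at hi
    change (toCLM i).range = (toCLM f).ker at hr
    have hadj : ∀ k, ContinuousLinearMap.adjoint (toCLM i) (toCLM i k) = k := fun k => by
      refine ext_inner_right ℂ fun z => ?_
      rw [ContinuousLinearMap.adjoint_inner_left]
      exact (⟨(toCLM i).toLinearMap, (AddMonoidHomClass.isometry_iff_norm _).1 hi⟩ :
        space K →ₗᵢ[ℂ] space X).inner_map_map k z
    have hif : i ≫ f = 0 := toCLM_injective (by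
      rw [toCLM_comp, toCLM_zero]
      ext k
      have : toCLM i k ∈ (toCLM f).ker := hr ▸ ⟨k, rfl⟩
      exact this)
    refine HasLimit.mk ⟨KernelFork.ofι i hif, KernelFork.IsLimit.ofι i hif
      (fun {W} g _ => g ≫ adj i) (fun {W} g hg => toCLM_injective ?_)
      (fun {W} g hg m hm => toCLM_injective ?_)⟩
    · rw [toCLM_comp, toCLM_comp, toCLM_adj]
      ext x
      have hx : toCLM g x ∈ (toCLM i).range := by
        rw [hr]
        have := congrArg (fun φ => toCLM φ x) hg
        simpa [toCLM_comp, toCLM_zero] using this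
      obtain ⟨k, hk⟩ := hx
      change toCLM i (ContinuousLinearMap.adjoint (toCLM i) (toCLM g x)) = toCLM g x
      rw [← hk]
      exact congrArg (toCLM i) (hadj k)
    · rw [← hm, toCLM_comp, toCLM_comp, toCLM_adj]
      ext x
      exact (hadj (toCLM m x)).symm

end HilbertCategory

/-! ### The extended category -/

/-- An object of the extended category of `C` is a morphism `hom : src ⟶ tgt` of `C`; it plays the
role of the cokernel of `hom`. -/
structure ExtCat (C : Type u) [Category.{v} C] where
  {src : C}
  {tgt : C}
  hom : src ⟶ tgt

namespace ExtCat

theorem square_comp {C : Type u} [Category.{v} C] {X Y Z : ExtCat C} {f : X.tgt ⟶ Y.tgt} {g : Y.tgt ⟶ Z.tgt}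
    (hf : ∃ f₁ : X.src ⟶ Y.src, X.hom ≫ f = f₁ ≫ Y.hom)
    (hg : ∃ g₁ : Y.src ⟶ Z.src, Y.hom ≫ g = g₁ ≫ Z.hom) :
    ∃ h₁ : X.src ⟶ Z.src, X.hom ≫ f ≫ g = h₁ ≫ Z.hom := by
  obtain ⟨f₁, hf⟩ := hf
  obtain ⟨g₁, hg⟩ := hg
  exact ⟨f₁ ≫ g₁, by rw [← Category.assoc, hf, Category.assoc, hg, Category.assoc]⟩

section Preadditive

variable {C : Type u} [Category.{v} C] [Preadditive C]

/-- The morphisms `f` between the targets that can be completed to a commutative square. -/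
def squares (X Y : ExtCat C) : AddSubgroup (X.tgt ⟶ Y.tgt) where
  carrier := {f | ∃ g : X.src ⟶ Y.src, X.hom ≫ f = g ≫ Y.hom}
  add_mem' := by
    rintro f f' ⟨g, hg⟩ ⟨g', hg'⟩
    exact ⟨g + g', by simp [hg, hg']⟩
  zero_mem' := ⟨0, by simp⟩
  neg_mem' := by
    rintro f ⟨g, hg⟩
    exact ⟨-g, by simp [hg]⟩

/-- The morphisms between the targets that factor through the target object `Y.hom`. -/
def nullSquares (X Y : ExtCat C) : AddSubgroup (squares X Y) where
  carrier := {f | ∃ F : X.tgt ⟶ Y.src, f.1 = F ≫ Y.hom}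
  add_mem' := by
    rintro f f' ⟨F, hF⟩ ⟨F', hF'⟩
    exact ⟨F + F', by simp [hF, hF']⟩
  zero_mem' := ⟨0, by simp⟩
  neg_mem' := by
    rintro f ⟨F, hF⟩
    exact ⟨-F, by simp [hF]⟩

/-- A morphism of the extended category is a class of morphisms `f : X.tgt ⟶ Y.tgt` that can be
completed to a commutative square, where `f` and `f'` are identified if `f - f'` factors through
`Y.hom`. -/
def Hom (X Y : ExtCat C) : Type v := squares X Y ⧸ nullSquares X Y

instance (X Y : ExtCat C) : AddCommGroup (Hom X Y) :=
  inferInstanceAs (AddCommGroup (squares X Y ⧸ nullSquares X Y))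

/-- The class of a square. -/
def Hom.mk {X Y : ExtCat C} (f : X.tgt ⟶ Y.tgt)
    (h : ∃ g : X.src ⟶ Y.src, X.hom ≫ f = g ≫ Y.hom) : Hom X Y :=
  QuotientAddGroup.mk (s := nullSquares X Y) ⟨f, h⟩

theorem Hom.exists_rep {X Y : ExtCat C} (φ : Hom X Y) : ∃ f h, φ = Hom.mk f h := by
  obtain ⟨⟨f, h⟩, rfl⟩ := QuotientAddGroup.mk_surjective φ
  exact ⟨f, h, rfl⟩

theorem Hom.mk_eq_iff {X Y : ExtCat C} {f f' : X.tgt ⟶ Y.tgt} {h h'} :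
    (Hom.mk f h : Hom X Y) = Hom.mk f' h' ↔ ∃ F : X.tgt ⟶ Y.src, f - f' = F ≫ Y.hom := by
  have : (Hom.mk f h : Hom X Y) = Hom.mk f' h' ↔
      (⟨f', h'⟩ : squares X Y) - ⟨f, h⟩ ∈ nullSquares X Y := by
    rw [sub_eq_neg_add]
    exact QuotientAddGroup.eq
  rw [this]
  constructor
  · rintro ⟨F, hF⟩
    refine ⟨-F, ?_⟩
    have hF' : f' - f = F ≫ Y.hom := hF
    rw [Preadditive.neg_comp, ← hF', neg_sub]
  · rintro ⟨F, hF⟩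
    refine ⟨-F, ?_⟩
    change f' - f = _
    rw [Preadditive.neg_comp, ← hF, neg_sub]

/-- Composition of classes of squares. -/
def Hom.comp {X Y Z : ExtCat C} (φ : Hom X Y) (ψ : Hom Y Z) : Hom X Z :=
  Quotient.liftOn₂' φ ψ
    (fun f g => Hom.mk (f.1 ≫ g.1) (by
      obtain ⟨f, f₁, hf⟩ := f
      obtain ⟨g, g₁, hg⟩ := g
      exact ⟨f₁ ≫ g₁, by rw [← Category.assoc, hf, Category.assoc, hg, Category.assoc]⟩))
    (by
      rintro ⟨f, hf⟩ ⟨g, hg⟩ ⟨f', hf'⟩ ⟨g', hg'⟩ h₁ h₂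
      obtain ⟨F, hF⟩ := Hom.mk_eq_iff.1 (Quotient.sound' h₁ : Hom.mk f hf = Hom.mk f' hf')
      obtain ⟨G, hG⟩ := Hom.mk_eq_iff.1 (Quotient.sound' h₂ : Hom.mk g hg = Hom.mk g' hg')
      obtain ⟨k, hk⟩ := hg
      refine Hom.mk_eq_iff.2 ⟨F ≫ k + f' ≫ G, ?_⟩
      rw [Preadditive.add_comp, Category.assoc, ← hk, ← Category.assoc, ← hF, Category.assoc, ← hG]
      simp)

instance : Category (ExtCat C) where
  Hom X Y := Hom X Y
  id X := Hom.mk (𝟙 _) ⟨𝟙 _, by simp⟩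
  comp φ ψ := Hom.comp φ ψ
  id_comp φ := by
    obtain ⟨f, h, rfl⟩ := Hom.exists_rep φ
    exact Hom.mk_eq_iff.2 ⟨0, by simp⟩
  comp_id φ := by
    obtain ⟨f, h, rfl⟩ := Hom.exists_rep φ
    exact Hom.mk_eq_iff.2 ⟨0, by simp⟩
  assoc φ ψ χ := by
    obtain ⟨f, h, rfl⟩ := Hom.exists_rep φ
    obtain ⟨f', h', rfl⟩ := Hom.exists_rep ψ
    obtain ⟨f'', h'', rfl⟩ := Hom.exists_rep χ
    exact Hom.mk_eq_iff.2 ⟨0, by simp⟩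

/-- The morphism of the extended category represented by `f`. -/
def homMk {X Y : ExtCat C} (f : X.tgt ⟶ Y.tgt)
    (h : ∃ g : X.src ⟶ Y.src, X.hom ≫ f = g ≫ Y.hom) : X ⟶ Y := Hom.mk f h

theorem exists_rep {X Y : ExtCat C} (φ : X ⟶ Y) : ∃ f h, φ = homMk f h := Hom.exists_rep φ

theorem homMk_eq_iff {X Y : ExtCat C} {f f' : X.tgt ⟶ Y.tgt} {h h'} :
    (homMk f h : X ⟶ Y) = homMk f' h' ↔ ∃ F : X.tgt ⟶ Y.src, f - f' = F ≫ Y.hom :=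
  Hom.mk_eq_iff

theorem homMk_congr {X Y : ExtCat C} {f f' : X.tgt ⟶ Y.tgt} {h} (e : f = f') :
    (homMk f h : X ⟶ Y) = homMk f' (e ▸ h) := by
  subst e; rfl

theorem id_eq (X : ExtCat C) : 𝟙 X = homMk (𝟙 X.tgt) ⟨𝟙 _, by simp⟩ := rfl

theorem homMk_comp {X Y Z : ExtCat C} (f : X.tgt ⟶ Y.tgt) (g : Y.tgt ⟶ Z.tgt) (hf hg) :
    (homMk f hf : X ⟶ Y) ≫ (homMk g hg : Y ⟶ Z) = homMk (f ≫ g) (square_comp hf hg) := rfl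

instance : Preadditive (ExtCat C) where
  homGroup X Y := inferInstanceAs (AddCommGroup (Hom X Y))
  add_comp X Y Z φ φ' ψ := by
    obtain ⟨f, h, rfl⟩ := exists_rep φ
    obtain ⟨f', h', rfl⟩ := exists_rep φ'
    obtain ⟨f'', h'', rfl⟩ := exists_rep ψ
    exact Hom.mk_eq_iff.2 ⟨0, by simp⟩
  comp_add X Y Z φ ψ ψ' := by
    obtain ⟨f, h, rfl⟩ := exists_rep φ
    obtain ⟨f', h', rfl⟩ := exists_rep ψ
    obtain ⟨f'', h'', rfl⟩ := exists_rep ψ'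
    exact Hom.mk_eq_iff.2 ⟨0, by simp⟩

theorem homMk_add {X Y : ExtCat C} (f g : X.tgt ⟶ Y.tgt) (hf hg) :
    (homMk f hf : X ⟶ Y) + homMk g hg = homMk (f + g) ((squares X Y).add_mem hf hg) := rfl

theorem homMk_zero (X Y : ExtCat C) :
    (0 : X ⟶ Y) = homMk 0 (squares X Y).zero_mem := rfl

theorem homMk_eq_zero_iff {X Y : ExtCat C} {f : X.tgt ⟶ Y.tgt} {h} :
    (homMk f h : X ⟶ Y) = 0 ↔ ∃ F : X.tgt ⟶ Y.src, f = F ≫ Y.hom := by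
  refine Iff.trans (homMk_eq_iff (f' := 0) (h' := (squares X Y).zero_mem)) ?_
  simp

variable (C) in
/-- Passing to the class of a square is additive. -/
def homMkHom (X Y : ExtCat C) : squares X Y →+ (X ⟶ Y) where
  toFun f := homMk f.1 f.2
  map_zero' := rfl
  map_add' _ _ := rfl

end Preadditive

section Abelian

variable {C : Type u} [Category.{v} C] [Preadditive C] [HasFiniteBiproducts C]

instance : HasFiniteBiproducts (ExtCat C) where
  out n :=
    { has_biproduct := fun X => by
        classical
        refine hasBiproduct_of_total
          { pt := ⟨biproduct.map fun j => (X j).hom⟩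
            π := fun j => homMk (biproduct.π (fun j => (X j).tgt) j)
              ⟨biproduct.π (fun j => (X j).src) j, by simp⟩
            ι := fun j => homMk (biproduct.ι (fun j => (X j).tgt) j)
              ⟨biproduct.ι (fun j => (X j).src) j, by simp⟩
            ι_π := fun j j' => ?_ } ?_
        · rw [homMk_comp]
          by_cases h : j = j'
          · subst h
            rw [dif_pos rfl]
            exact homMk_congr (by simp)
          · rw [dif_neg h, homMk_zero]
            exact homMk_congr (by simp [biproduct.ι_π_ne _ h])
        · let P : ExtCat C := ⟨biproduct.map fun j => (X j).hom⟩
          let s : Fin n → squares P P := fun j =>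
            ⟨biproduct.π (fun j => (X j).tgt) j ≫ biproduct.ι (fun j => (X j).tgt) j,
              biproduct.π (fun j => (X j).src) j ≫ biproduct.ι (fun j => (X j).src) j, by
                simp [P]⟩
          have h₁ : ∑ j, homMkHom C P P (s j) = homMkHom C P P (∑ j, s j) := (map_sum _ _ _).symm
          refine h₁.trans ?_
          refine homMk_congr ?_
          rw [AddSubgroup.val_finsetSum]
          exact biproduct.total }

instance : HasZeroObject (ExtCat C) := hasZeroObject_of_hasFiniteBiproducts _

instance : HasBinaryBiproducts C := hasBinaryBiproducts_of_finite_biproducts C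

/-- The cokernel of the class of `f : A ⟶ B` from `α : A' ⟶ A` to `β : B' ⟶ B` is
`(f, β) : A ⊞ B' ⟶ B`. -/
abbrev coker {X Y : ExtCat C} (f : X.tgt ⟶ Y.tgt) : ExtCat C := ⟨biprod.desc f Y.hom⟩

/-- The projection onto the cokernel. -/
def cokerπ {X Y : ExtCat C} (f : X.tgt ⟶ Y.tgt) : Y ⟶ coker f :=
  homMk (𝟙 _) ⟨biprod.inr, by simp [coker]⟩

theorem comp_cokerπ {X Y : ExtCat C} (f : X.tgt ⟶ Y.tgt) (h) :
    (homMk f h : X ⟶ Y) ≫ cokerπ f = 0 := by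
  rw [cokerπ, homMk_comp, homMk_eq_zero_iff]
  exact ⟨biprod.inl, by simp [coker]⟩

instance {X Y : ExtCat C} (f : X.tgt ⟶ Y.tgt) : Epi (cokerπ f) := by
  refine Preadditive.epi_of_cancel_zero _ fun {Z} φ hφ => ?_
  obtain ⟨k, hk, rfl⟩ := exists_rep φ
  rw [cokerπ, homMk_comp, homMk_eq_zero_iff] at hφ
  rw [homMk_eq_zero_iff]
  simpa using hφ

/-- The universal property of the cokernel. -/
def isColimitCoker {X Y : ExtCat C} (f : X.tgt ⟶ Y.tgt) (h) :
    IsColimit (CokernelCofork.ofπ (cokerπ f) (comp_cokerπ f h)) :=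
  CokernelCofork.IsColimit.ofπ' _ _ fun {Z} φ hφ => by
    have : ∃ ψ : coker f ⟶ Z, cokerπ f ≫ ψ = φ := by
      obtain ⟨k, ⟨k₁, hk⟩, rfl⟩ := exists_rep φ
      rw [homMk_comp, homMk_eq_zero_iff] at hφ
      obtain ⟨F, hF⟩ := hφ
      refine ⟨homMk k ⟨biprod.desc F k₁, ?_⟩, ?_⟩
      · apply biprod.hom_ext'
        · simpa [coker] using hF
        · simpa [coker] using hk
      · rw [cokerπ, homMk_comp]
        exact homMk_congr (by simp)
    exact ⟨this.choose, this.choose_spec⟩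

instance : HasCokernels (ExtCat C) where
  has_colimit {X Y} φ := by
    obtain ⟨f, h, rfl⟩ := exists_rep φ
    exact HasColimit.mk ⟨_, isColimitCoker f h⟩

variable [HasKernels C]

instance : HasEqualizers C := Preadditive.hasEqualizers_of_hasKernels

instance : HasPullbacks C := hasPullbacks_of_hasBinaryProducts_of_hasEqualizers C

/-- The kernel of the class of `f : A ⟶ B` from `α : A' ⟶ A` to `β : B' ⟶ B` is the second
projection `P ×_A A' ⟶ P`, where `P = A ×_B B'`. -/
abbrev ker {X Y : ExtCat C} (f : X.tgt ⟶ Y.tgt) : ExtCat C :=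
  ⟨pullback.fst (pullback.fst f Y.hom) X.hom⟩

/-- The inclusion of the kernel. -/
def kerι {X Y : ExtCat C} (f : X.tgt ⟶ Y.tgt) : ker f ⟶ X :=
  homMk (pullback.fst f Y.hom) ⟨pullback.snd _ _, pullback.condition⟩

theorem kerι_comp {X Y : ExtCat C} (f : X.tgt ⟶ Y.tgt) (h) :
    kerι f ≫ (homMk f h : X ⟶ Y) = 0 := by
  rw [kerι, homMk_comp, homMk_eq_zero_iff]
  exact ⟨pullback.snd _ _, pullback.condition⟩

instance {X Y : ExtCat C} (f : X.tgt ⟶ Y.tgt) : Mono (kerι f) := by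
  refine Preadditive.mono_of_cancel_zero _ fun {Z} φ hφ => ?_
  obtain ⟨k, hk, rfl⟩ := exists_rep φ
  rw [kerι, homMk_comp, homMk_eq_zero_iff] at hφ
  obtain ⟨F, hF⟩ := hφ
  rw [homMk_eq_zero_iff]
  exact ⟨pullback.lift k F hF, (pullback.lift_fst _ _ _).symm⟩

/-- The universal property of the kernel. -/
def isLimitKer {X Y : ExtCat C} (f : X.tgt ⟶ Y.tgt) (h) :
    IsLimit (KernelFork.ofι (kerι f) (kerι_comp f h)) :=
  KernelFork.IsLimit.ofι' _ _ fun {Z} φ hφ => by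
    have : ∃ ψ : Z ⟶ ker f, ψ ≫ kerι f = φ := by
      obtain ⟨k, ⟨k₁, hk⟩, rfl⟩ := exists_rep φ
      rw [homMk_comp, homMk_eq_zero_iff] at hφ
      obtain ⟨F, hF⟩ := hφ
      refine ⟨homMk (pullback.lift k F hF)
        ⟨pullback.lift (Z.hom ≫ pullback.lift k F hF) k₁
          (by rw [Category.assoc, pullback.lift_fst, hk]), ?_⟩, ?_⟩
      · exact (pullback.lift_fst _ _ _).symm
      · rw [kerι, homMk_comp]
        exact homMk_congr (pullback.lift_fst _ _ _)
    exact ⟨this.choose, this.choose_spec⟩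

instance : HasKernels (ExtCat C) where
  has_limit {X Y} φ := by
    obtain ⟨f, h, rfl⟩ := exists_rep φ
    exact HasLimit.mk ⟨_, isLimitKer f h⟩

theorem exists_normalMono {X Y : ExtCat C} (φ : X ⟶ Y) [Mono φ] : Nonempty (NormalMono φ) := by
  obtain ⟨f, h, rfl⟩ := exists_rep φ
  have h₀ : kerι f = 0 := by
    rw [← cancel_mono (homMk f h : X ⟶ Y), kerι_comp, zero_comp]
  rw [kerι, homMk_eq_zero_iff] at h₀
  obtain ⟨t, ht⟩ := h₀
  refine ⟨⟨coker f, cokerπ f, comp_cokerπ f h, KernelFork.IsLimit.ofι' _ _ fun {Z} ψ hψ => ?_⟩⟩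
  have : ∃ χ : Z ⟶ X, χ ≫ homMk f h = ψ := by
    obtain ⟨k, ⟨k₁, hk⟩, rfl⟩ := exists_rep ψ
    rw [cokerπ, homMk_comp, homMk_eq_zero_iff] at hψ
    obtain ⟨F, hF⟩ := hψ
    have hF' : k = (F ≫ biprod.fst) ≫ f + (F ≫ biprod.snd) ≫ Y.hom := by
      have : F = (F ≫ biprod.fst) ≫ biprod.inl + (F ≫ biprod.snd) ≫ biprod.inr := by
        apply biprod.hom_ext <;> simp
      rw [Category.comp_id] at hF
      rw [hF]
      conv_lhs => rw [this]
      simp [coker]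
    have hc : (Z.hom ≫ F ≫ biprod.fst) ≫ f = (k₁ - Z.hom ≫ F ≫ biprod.snd) ≫ Y.hom := by
      rw [Preadditive.sub_comp, ← hk]
      conv_rhs => rw [hF']
      simp
    refine ⟨homMk (F ≫ biprod.fst) ⟨pullback.lift _ _ hc ≫ t, ?_⟩, ?_⟩
    · rw [Category.assoc]
      refine Eq.trans ?_ (congrArg (pullback.lift _ _ hc ≫ ·) ht)
      exact (pullback.lift_fst _ _ hc).symm
    · rw [homMk_comp, homMk_eq_iff]
      refine ⟨-(F ≫ biprod.snd), ?_⟩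
      conv_lhs => rw [hF']
      simp
  exact ⟨this.choose, this.choose_spec⟩

theorem exists_normalEpi {X Y : ExtCat C} (φ : X ⟶ Y) [Epi φ] : Nonempty (NormalEpi φ) := by
  obtain ⟨f, h, rfl⟩ := exists_rep φ
  have h₀ : cokerπ f = 0 := by
    rw [← cancel_epi (homMk f h : X ⟶ Y), comp_cokerπ, comp_zero]
  rw [cokerπ, homMk_eq_zero_iff] at h₀
  obtain ⟨F, hF⟩ := h₀
  obtain ⟨s, t, hst⟩ : ∃ (s : Y.tgt ⟶ X.tgt) (t : Y.tgt ⟶ Y.src),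
      𝟙 Y.tgt = s ≫ f + t ≫ Y.hom := by
    refine ⟨F ≫ biprod.fst, F ≫ biprod.snd, ?_⟩
    have : F = (F ≫ biprod.fst) ≫ biprod.inl + (F ≫ biprod.snd) ≫ biprod.inr := by
      apply biprod.hom_ext <;> simp
    refine hF.trans ?_
    conv_lhs => rw [this]
    simp [coker]
  refine ⟨⟨ker f, kerι f, kerι_comp f h, CokernelCofork.IsColimit.ofπ' _ _ fun {Z} ψ hψ => ?_⟩⟩
  have : ∃ χ : Y ⟶ Z, homMk f h ≫ χ = ψ := by
    obtain ⟨k, ⟨k₁, hk⟩, rfl⟩ := exists_rep ψ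
    rw [kerι, homMk_comp, homMk_eq_zero_iff] at hψ
    obtain ⟨G, hG⟩ := hψ
    have h₁ : (Y.hom ≫ s) ≫ f = (𝟙 _ - Y.hom ≫ t) ≫ Y.hom := by
      have := congrArg (Y.hom ≫ ·) hst
      simp only [Category.comp_id, Preadditive.comp_add] at this
      rw [Preadditive.sub_comp, Category.id_comp]
      nth_rewrite 2 [this]
      simp
    have h₂ : (𝟙 _ - f ≫ s) ≫ f = (f ≫ t) ≫ Y.hom := by
      have := congrArg (f ≫ ·) hst
      simp only [Category.comp_id, Preadditive.comp_add] at this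
      rw [Preadditive.sub_comp, Category.id_comp]
      nth_rewrite 1 [this]
      simp
    refine ⟨homMk (s ≫ k) ⟨pullback.lift _ _ h₁ ≫ G, ?_⟩, ?_⟩
    · rw [Category.assoc]
      refine Eq.trans ?_ (congrArg (pullback.lift _ _ h₁ ≫ ·) hG)
      rw [pullback.lift_fst_assoc, Category.assoc]
    · rw [homMk_comp, homMk_eq_iff]
      refine ⟨-(pullback.lift _ _ h₂ ≫ G), ?_⟩
      rw [Preadditive.neg_comp, Category.assoc]
      have := congrArg (pullback.lift _ _ h₂ ≫ ·) hG
      refine Eq.trans ?_ (congrArg (- ·) this)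
      rw [pullback.lift_fst_assoc]
      simp
  exact ⟨this.choose, this.choose_spec⟩

/-- The extended category of an additive category with kernels is an abelian category. -/
instance : Abelian (ExtCat C) where
  normalMonoOfMono φ _ := exists_normalMono φ
  normalEpiOfEpi φ _ := exists_normalEpi φ
  has_finite_products := inferInstance

end Abelian

variable {C : Type u} [Category.{v} C] [HilbertCategory C]

variable (C) in
/-- The embedding of a Hilbert category into its extended category, `A ↦ (0 ⟶ A)`. -/
def emb : C ⥤ ExtCat C where
  obj A := ⟨(0 : (0 : C) ⟶ A)⟩
  map f := homMk f ⟨0, by simp⟩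

instance : (emb C).Additive where

theorem homMk_comp_emb_eq_zero_iff {Z : ExtCat C} {A B : C} (k : Z.tgt ⟶ A) (hk) (f : A ⟶ B) :
    (homMk k hk : Z ⟶ (emb C).obj A) ≫ (emb C).map f = 0 ↔ k ≫ f = 0 := by
  refine (homMk_eq_zero_iff (Y := (emb C).obj B) (f := k ≫ f)).trans ⟨?_, fun h => ⟨0, ?_⟩⟩
  · rintro ⟨F, hF⟩
    exact hF.trans comp_zero
  · exact h.trans zero_comp.symm

/-- The extended homology of a chain complex, `(d : C_{n+1} ⟶ Z_n)`, where `Z_n` is the kernel of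
`d : C_n ⟶ C_{n-1}` (for `n = 0` the differential `K.d 0 (0 - 1) = K.d 0 0` is zero, so that
`Z_0 = C_0`). It is the homology of the complex in the abelian category `ExtCat C`, see
`nonempty_homology_iso` below. -/
def homology (K : ChainComplex C ℕ) (n : ℕ) : ExtCat C :=
  ⟨kernel.lift (K.d n (n - 1)) (K.d (n + 1) n) (K.d_comp_d _ _ _)⟩

/-- The extended homology in degree `n` is the homology in degree `n` of the complex that the
embedding of `C` into the abelian category `ExtCat C` makes of a chain complex of `C`. -/
theorem nonempty_homology_iso (K : ChainComplex C ℕ) (n : ℕ) :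
    Nonempty ((((emb C).mapHomologicalComplex (ComplexShape.down ℕ)).obj K).homology n ≅
      homology K n) := by
  let L := ((emb C).mapHomologicalComplex (ComplexShape.down ℕ)).obj K
  have hnext : (ComplexShape.down ℕ).next n = n - 1 := by
    cases n with
    | zero => simp
    | succ n => simp
  let S := L.sc' (n + 1) n (n - 1)
  let i : (emb C).obj (kernel (K.d n (n - 1))) ⟶ S.X₂ := (emb C).map (kernel.ι _)
  have wi : i ≫ S.g = 0 := by
    change (emb C).map (kernel.ι _) ≫ (emb C).map (K.d n (n - 1)) = 0
    rw [← Functor.map_comp, kernel.condition, Functor.map_zero]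
  have hker : ∀ {W : C} (k : W ⟶ kernel (K.d n (n - 1))), k ≫ kernel.ι _ = 0 → k = 0 :=
    fun k hk => zero_of_comp_mono _ hk
  have hi : IsLimit (KernelFork.ofι i wi) := by
    haveI : Mono i := by
      refine Preadditive.mono_of_cancel_zero _ fun {Z} φ hφ => ?_
      obtain ⟨k, hk, rfl⟩ := exists_rep φ
      have hk' := (homMk_comp_emb_eq_zero_iff k hk (kernel.ι (K.d n (n - 1)))).1 hφ
      exact homMk_eq_zero_iff.2 ⟨0, (hker k hk').trans zero_comp.symm⟩
    refine KernelFork.IsLimit.ofι' _ _ fun {Z} φ hφ => ?_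
    have : ∃ ψ : Z ⟶ (emb C).obj (kernel (K.d n (n - 1))), ψ ≫ i = φ := by
      obtain ⟨k, ⟨k₁, hk⟩, rfl⟩ := exists_rep φ
      have hF' := (homMk_comp_emb_eq_zero_iff k ⟨k₁, hk⟩ (K.d n (n - 1))).1 hφ
      refine ⟨homMk (kernel.lift _ k hF') ⟨0, ?_⟩, homMk_congr (kernel.lift_ι _ _ _)⟩
      refine Eq.trans (hker (Z.hom ≫ kernel.lift (K.d n (n - 1)) k hF') ?_) zero_comp.symm
      refine (Category.assoc _ _ _).trans ?_
      refine (congrArg (Z.hom ≫ ·) (kernel.lift_ι (K.d n (n - 1)) k hF')).trans ?_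
      exact hk.trans comp_zero
    exact ⟨this.choose, this.choose_spec⟩
  let l : K.X (n + 1) ⟶ kernel (K.d n (n - 1)) :=
    kernel.lift (K.d n (n - 1)) (K.d (n + 1) n) (K.d_comp_d _ _ _)
  let p : (emb C).obj (kernel (K.d n (n - 1))) ⟶ homology K n := homMk (𝟙 (kernel (K.d n (n - 1)))) ⟨0, by
    rw [zero_comp]
    exact zero_comp⟩
  have hl : hi.lift (KernelFork.ofι _ S.zero) = (emb C).map l := by
    refine Fork.IsLimit.hom_ext hi ?_
    rw [Fork.IsLimit.lift_ι]
    change (emb C).map (K.d (n + 1) n) = (emb C).map l ≫ (emb C).map (kernel.ι _)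
    rw [← Functor.map_comp, kernel.lift_ι]
  have wp : hi.lift (KernelFork.ofι _ S.zero) ≫ p = 0 := by
    rw [hl]
    refine (homMk_eq_zero_iff (X := (emb C).obj (K.X (n + 1))) (Y := homology K n)
      (f := l ≫ 𝟙 _)).2 ⟨𝟙 (K.X (n + 1)), ?_⟩
    exact (Category.comp_id l).trans (Category.id_comp l).symm
  have hp : IsColimit (CokernelCofork.ofπ p wp) := by
    haveI : Epi p := by
      refine Preadditive.epi_of_cancel_zero _ fun {Z} φ hφ => ?_
      obtain ⟨k, hk, rfl⟩ := exists_rep φ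
      obtain ⟨F, hF⟩ := (homMk_eq_zero_iff (X := (emb C).obj (kernel (K.d n (n - 1))))
        (f := 𝟙 (kernel (K.d n (n - 1))) ≫ k)).1 hφ
      exact homMk_eq_zero_iff.2 ⟨F, (Category.id_comp k).symm.trans hF⟩
    refine CokernelCofork.IsColimit.ofπ' _ _ fun {Z} φ hφ => ?_
    have : ∃ ψ : homology K n ⟶ Z, p ≫ ψ = φ := by
      rw [hl] at hφ
      obtain ⟨k, ⟨k₁, hk⟩, rfl⟩ := exists_rep φ
      obtain ⟨F, hF⟩ := (homMk_eq_zero_iff (X := (emb C).obj (K.X (n + 1))) (f := l ≫ k)).1 hφ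
      exact ⟨homMk k ⟨F, hF⟩, homMk_congr (Category.id_comp _)⟩
    exact ⟨this.choose, this.choose_spec⟩
  let h : S.LeftHomologyData :=
    { K := _, H := homology K n, i := i, π := p, wi := wi, hi := hi, wπ := wp, hπ := hp }
  exact ⟨L.homologyIsoSc' (n + 1) n (n - 1) (by simp) hnext ≪≫ h.homologyIso⟩

/-- The inclusion of the orthogonal complement of `ker f` into the source of `f`. It is obtained as
the kernel of the adjoint of the inclusion of `ker f`. -/
abbrev coimι {A B : C} (f : A ⟶ B) : kernel (HilbertCategory.adj (kernel.ι f)) ⟶ A := kernel.ι _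

/-- The restriction of `α : A' ⟶ A` to the orthogonal complement of `ker α`. This is an injective
morphism, and it represents the same object of the extended category as `α`. -/
abbrev reduce (X : ExtCat C) : ExtCat C := ⟨coimι X.hom ≫ X.hom⟩

theorem coimι_adj {A B : C} (f : A ⟶ B) : coimι f ≫ HilbertCategory.adj (kernel.ι f) = 0 :=
  kernel.condition _

open HilbertCategory in
theorem reduce_injective (X : ExtCat C) : Function.Injective (toCLM X.reduce.hom) := by
  have hm : Mono X.reduce.hom := by
    refine Preadditive.mono_of_cancel_zero _ fun {W} w hw => ?_
    have hw' : (w ≫ coimι X.hom) ≫ X.hom = 0 := (Category.assoc _ _ _).trans hw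
    have h₁ : kernel.lift _ _ hw' ≫ kernel.ι X.hom = w ≫ coimι X.hom := kernel.lift_ι _ _ _
    have h₂ : (w ≫ coimι X.hom) ≫ adj (kernel.ι X.hom) = 0 := by
      rw [Category.assoc, coimι_adj, comp_zero]
    have h₃ : w ≫ coimι X.hom = 0 := by
      rw [← h₁] at h₂ ⊢
      refine toCLM_injective ?_
      ext x
      have h := congrArg (fun φ => toCLM φ x) h₂
      simp only [toCLM_comp, toCLM_adj, toCLM_zero, ContinuousLinearMap.comp_apply,
        zero_apply] at h ⊢
      rw [← inner_self_eq_zero (𝕜 := ℂ), ← ContinuousLinearMap.adjoint_inner_left, h,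
        inner_zero_left]
    exact zero_of_comp_mono (kernel.ι (adj (kernel.ι X.hom))) h₃
  obtain ⟨K, i, -, hr⟩ := exists_kernel X.reduce.hom
  change (toCLM i).range = (toCLM X.reduce.hom).ker at hr
  have hi : i = 0 := by
    refine zero_of_comp_mono X.reduce.hom (toCLM_injective ?_)
    rw [toCLM_comp, toCLM_zero]
    ext x
    have : toCLM i x ∈ (toCLM X.reduce.hom).ker := hr ▸ ⟨x, rfl⟩
    exact this
  refine (injective_iff_map_eq_zero _).2 fun x hx => ?_
  have : x ∈ (toCLM i).range := by
    rw [hr]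
    exact hx
  obtain ⟨y, rfl⟩ := this
  rw [hi, toCLM_zero]
  rfl

open HilbertCategory in
theorem nonempty_reduce_iso (X : ExtCat C) : Nonempty (X.reduce ≅ X) := by
  obtain ⟨K, i, hi, hr⟩ := exists_kernel X.hom
  change Isometry (toCLM i) at hi
  change (toCLM i).range = (toCLM X.hom).ker at hr
  have hadj : i ≫ adj i = 𝟙 K := toCLM_injective (by
    rw [toCLM_comp, toCLM_adj, toCLM_id]
    exact (ContinuousLinearMap.norm_map_iff_adjoint_comp_self _).1
      ((AddMonoidHomClass.isometry_iff_norm _).1 hi))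
  have hz : i ≫ X.hom = 0 := toCLM_injective (by
    rw [toCLM_comp, toCLM_zero]
    ext x
    have : toCLM i x ∈ (toCLM X.hom).ker := hr ▸ ⟨x, rfl⟩
    exact this)
  have hk : (𝟙 _ - adj i ≫ i) ≫ adj (kernel.ι X.hom) = 0 := by
    refine toCLM_injective ?_
    rw [toCLM_comp, toCLM_adj, toCLM_zero]
    ext x
    refine ext_inner_right ℂ fun y => ?_
    have hy : toCLM (kernel.ι X.hom) y ∈ (toCLM i).range := by
      rw [hr]
      have h := congrArg (fun φ => toCLM φ y) (kernel.condition X.hom)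
      rw [toCLM_comp, toCLM_zero] at h
      exact h
    obtain ⟨z, hz⟩ := hy
    have hz : toCLM (kernel.ι X.hom) y = toCLM i z := hz.symm
    rw [ContinuousLinearMap.comp_apply, ContinuousLinearMap.adjoint_inner_left, hz,
      ← ContinuousLinearMap.adjoint_inner_left, ← toCLM_adj, ← ContinuousLinearMap.comp_apply,
      ← toCLM_comp, Preadditive.sub_comp, Category.assoc, hadj, Category.id_comp, Category.comp_id,
      sub_self, toCLM_zero, zero_apply, zero_apply, inner_zero_left, inner_zero_left]
  have hc : X.hom = kernel.lift _ _ hk ≫ coimι X.hom ≫ X.hom := by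
    rw [← Category.assoc, kernel.lift_ι, Preadditive.sub_comp, Category.assoc, hz]
    simp
  refine ⟨⟨homMk (X := X.reduce) (Y := X) (𝟙 X.tgt) ⟨coimι X.hom, Category.comp_id _⟩,
    homMk (X := X) (Y := X.reduce) (𝟙 X.tgt) ⟨_, (Category.comp_id _).trans hc⟩, ?_, ?_⟩⟩
  · exact homMk_congr (Category.comp_id _)
  · exact homMk_congr (Category.comp_id _)

end ExtCat

/-! ### Tensor products -/

open HilbertCategory

variable (C₁ : Type u₁) [Category.{v₁} C₁] [HilbertCategory C₁]
  (C₂ : Type u₂) [Category.{v₂} C₂] [HilbertCategory C₂]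
  (C₃ : Type u₃) [Category.{v₃} C₃] [HilbertCategory C₃]

/-- A tensor product functor of Hilbert categories: a covariant functor of two variables for which
the Hilbert space underlying `X ⊗ Y` is the tensor product of the Hilbert spaces underlying `X` and
`Y`, that is, the completion of their algebraic tensor product for the inner product with
`⟪x ⊗ y, x' ⊗ y'⟫ = ⟪x, x'⟫ * ⟪y, y'⟫`, and for which `f ⊗ g` is the tensor product of the bounded
linear maps `f` and `g`. -/
structure HilbertTensor where
  functor : C₁ ⥤ C₂ ⥤ C₃
  equiv (X : C₁) (Y : C₂) : UniformSpace.Completion (space X ⊗[ℂ] space Y) ≃ₗᵢ[ℂ]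
    space ((functor.obj X).obj Y)
  toCLM_map {X X' : C₁} {Y Y' : C₂} (f : X ⟶ X') (g : Y ⟶ Y') (x : space X) (y : space Y) :
    toCLM ((functor.map f).app Y ≫ (functor.obj X').map g)
      (equiv X Y ((x ⊗ₜ[ℂ] y : space X ⊗[ℂ] space Y) : UniformSpace.Completion _)) =
    equiv X' Y' ((toCLM f x ⊗ₜ[ℂ] toCLM g y : space X' ⊗[ℂ] space Y') :
      UniformSpace.Completion _)

variable {C₁ C₂ C₃}

namespace HilbertTensor

variable (T : HilbertTensor C₁ C₂ C₃)

/-- A morphism out of `X ⊗ Y` that kills the elementary tensors is zero. -/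
theorem eq_zero {X : C₁} {Y : C₂} {Z : C₃} (φ : (T.functor.obj X).obj Y ⟶ Z)
    (h : ∀ (x : space X) (y : space Y), toCLM φ
      (T.equiv X Y ((x ⊗ₜ[ℂ] y : space X ⊗[ℂ] space Y) : UniformSpace.Completion _)) = 0) :
    φ = 0 := by
  apply toCLM_injective
  rw [toCLM_zero]
  ext z
  obtain ⟨c, rfl⟩ := (T.equiv X Y).surjective z
  induction c using UniformSpace.Completion.induction_on with
  | hp =>
    exact isClosed_eq ((toCLM φ).continuous.comp (T.equiv X Y).continuous) continuous_const
  | ih a =>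
    induction a using TensorProduct.induction_on with
    | zero => rw [UniformSpace.Completion.coe_zero, map_zero, map_zero, map_zero]
    | tmul x y => exact h x y
    | add a b ha hb =>
      rw [UniformSpace.Completion.coe_add, map_add, map_add, ha, hb, map_add]

instance : T.functor.PreservesZeroMorphisms where
  map_zero X X' := by
    ext Y
    refine T.eq_zero _ fun x y => ?_
    have := T.toCLM_map (0 : X ⟶ X') (𝟙 Y) x y
    rw [CategoryTheory.Functor.map_id, Category.comp_id, toCLM_zero] at this
    rw [this, zero_apply, TensorProduct.zero_tmul,
      UniformSpace.Completion.coe_zero, map_zero]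

instance (X : C₁) : (T.functor.obj X).PreservesZeroMorphisms where
  map_zero Y Y' := by
    refine T.eq_zero _ fun x y => ?_
    have := T.toCLM_map (𝟙 X) (0 : Y ⟶ Y') x y
    rw [CategoryTheory.Functor.map_id, NatTrans.id_app, Category.id_comp, toCLM_zero] at this
    rw [this, zero_apply, TensorProduct.tmul_zero,
      UniformSpace.Completion.coe_zero, map_zero]

instance (n : ℕ) : Finite (ComplexShape.π (ComplexShape.down ℕ) (ComplexShape.down ℕ)
    (ComplexShape.down ℕ) ⁻¹' {n}) :=
  inferInstanceAs (Finite ((fun i : ℕ × ℕ => i.1 + i.2) ⁻¹' {n}))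

/-- The tensor product of chain complexes, with the usual differential
`d (x ⊗ y) = d x ⊗ y + (-1) ^ deg x • x ⊗ d y`. -/
def complex (K : ChainComplex C₁ ℕ) (L : ChainComplex C₂ ℕ) : ChainComplex C₃ ℕ :=
  HomologicalComplex.mapBifunctor K L T.functor (ComplexShape.down ℕ)

section

variable {A' A : C₁} {B' B : C₂} (α : A' ⟶ A) (β : B' ⟶ B)

/-- The first differential `(-1 ⊗ β, α ⊗ 1) : A' ⊗ B' ⟶ (A' ⊗ B) ⊞ (A ⊗ B')` of the tensor product
of the complexes `α : A' ⟶ A` and `β : B' ⟶ B` of length one. -/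
def d₂ : (T.functor.obj A').obj B' ⟶
    (T.functor.obj A').obj B ⊞ (T.functor.obj A).obj B' :=
  biprod.lift (-(T.functor.obj A').map β) ((T.functor.map α).app B')

/-- The second differential `(α ⊗ 1, 1 ⊗ β) : (A' ⊗ B) ⊞ (A ⊗ B') ⟶ A ⊗ B` of the tensor product of
the complexes `α : A' ⟶ A` and `β : B' ⟶ B` of length one. -/
def d₁ : (T.functor.obj A').obj B ⊞ (T.functor.obj A).obj B' ⟶ (T.functor.obj A).obj B :=
  biprod.desc ((T.functor.map α).app B) ((T.functor.obj A).map β)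

theorem d₂_d₁ : T.d₂ α β ≫ T.d₁ α β = 0 := by
  rw [d₂, d₁, biprod.lift_desc, Preadditive.neg_comp, NatTrans.naturality, neg_add_cancel]

end

/-- The tensor product of objects of the extended categories, computed with injective
representatives `α : A' ⟶ A` and `β : B' ⟶ B`: the extended homology
`((α ⊗ 1, 1 ⊗ β) : (A' ⊗ B) ⊞ (A ⊗ B') ⟶ A ⊗ B)` in degree zero of the tensor product of
the two complexes of length one. -/
def tensor (X : ExtCat C₁) (Y : ExtCat C₂) : ExtCat C₃ :=
  ⟨T.d₁ X.reduce.hom Y.reduce.hom⟩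

/-- The periodic product of objects of the extended categories, computed with injective
representatives `α : A' ⟶ A` and `β : B' ⟶ B`: the extended homology `(A' ⊗ B' ⟶ Z)` in degree one
of the tensor product of the two complexes of length one, where `Z` is the kernel of
`(α ⊗ 1, 1 ⊗ β) : (A' ⊗ B) ⊞ (A ⊗ B') ⟶ A ⊗ B`. -/
def periodic (X : ExtCat C₁) (Y : ExtCat C₂) : ExtCat C₃ :=
  ⟨kernel.lift (T.d₁ X.reduce.hom Y.reduce.hom) (T.d₂ X.reduce.hom Y.reduce.hom) (T.d₂_d₁ _ _)⟩

end HilbertTensor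

instance (n : ℕ) : Finite {p : ℕ × ℕ // p.1 + p.2 = n} :=
  Finite.of_injective (fun p => ((⟨p.1.1, by omega⟩, ⟨p.1.2, by omega⟩) : Fin (n + 1) × Fin (n + 1)))
    fun p q h => by
      simp only [Prod.mk.injEq, Fin.mk.injEq] at h
      exact Subtype.ext (Prod.ext h.1 h.2)

instance (n : ℕ) : Finite {p : ℕ × ℕ // p.1 + p.2 + 1 = n} :=
  Finite.of_injective (fun p => ((⟨p.1.1, by omega⟩, ⟨p.1.2, by omega⟩) : Fin (n + 1) × Fin (n + 1)))
    fun p q h => by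
      simp only [Prod.mk.injEq, Fin.mk.injEq] at h
      exact Subtype.ext (Prod.ext h.1 h.2)

end

/-!
# The Künneth formula for extended homology

A Hilbert category has orthogonal projections onto kernels: the kernel of a morphism is a direct
summand of its source, with complement the kernel of an adjoint (`exists_kernel_splitting`).
Therefore a chain complex `K` splits in each degree into its cycles and their complement, and the
differential is a morphism from the complement in degree `i + 1` to the cycles in degree `i`. So `K`
is the direct sum of complexes of length one, its strands, and the `i`-th strand is precisely the
injective representative of the `i`-th extended homology of `K` that enters the definition of the
tensor product and of the periodic product (`exists_strand_decomposition`).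

The tensor product of complexes and homology are additive functors, so that the homology of `K ⊗ L`
is the direct sum, over all pairs `(i, j)`, of the homology of the tensor product of the `i`-th strand
of `K` and the `j`-th strand of `L` (`exists_total_of_biadditive`). The latter is, up to signs, the
complex `A' ⊗ B' ⟶ (A' ⊗ B) ⊞ (A ⊗ B') ⟶ A ⊗ B` in the degrees `i + j + 2`, `i + j + 1` and `i + j`.
Its extended homology is the tensor product in degree `i + j` (`nonempty_homology_double_bottom`) and
the periodic product in degree `i + j + 1` (`nonempty_homology_double_middle`). It is zero in degree
`i + j + 2` because there the differential is a monomorphism (`isZero_homology_double`): for injective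
`α` the range of the adjoint of `α` is dense, hence so is the range of the adjoint of `α ⊗ 1`
(`mono_map_app`).
-/

noncomputable section

open HilbertSpaceCat HilbertCategory HomologicalComplex

/-! ### Orthogonal splittings -/

namespace HilbertCategory

variable {C : Type u} [Category.{v} C] [HilbertCategory C]

theorem toCLM_add {X Y : C} (f g : X ⟶ Y) : toCLM (f + g) = toCLM f + toCLM g :=
  (inclusion C).map_add

theorem adj_comp {X Y Z : C} (f : X ⟶ Y) (g : Y ⟶ Z) : adj (f ≫ g) = adj g ≫ adj f :=
  toCLM_injective (by
    simp only [toCLM_comp, toCLM_adj, ContinuousLinearMap.adjoint_comp])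

theorem adj_adj {X Y : C} (f : X ⟶ Y) : adj (adj f) = f :=
  toCLM_injective (by rw [toCLM_adj, toCLM_adj, ContinuousLinearMap.adjoint_adjoint])

theorem adj_zero (X Y : C) : adj (0 : X ⟶ Y) = 0 :=
  toCLM_injective (by rw [toCLM_adj, toCLM_zero, toCLM_zero, map_zero])

/-- The kernel of a morphism and its orthogonal complement decompose the source. A chosen categorical
kernel need not be isometrically embedded, so the retraction `r` need not be an adjoint. -/
theorem exists_kernel_splitting {X Y : C} (f : X ⟶ Y) :
    ∃ (r : X ⟶ kernel f) (s : X ⟶ kernel (adj (kernel.ι f))),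
      kernel.ι f ≫ r = 𝟙 _ ∧ ExtCat.coimι f ≫ s = 𝟙 _ ∧
      r ≫ kernel.ι f + s ≫ ExtCat.coimι f = 𝟙 X ∧
      kernel.ι f ≫ s = 0 ∧ ExtCat.coimι f ≫ r = 0 := by
  obtain ⟨K, i, hi, hr⟩ := exists_kernel f
  change Isometry (toCLM i) at hi
  change (toCLM i).range = (toCLM f).ker at hr
  have hadj : i ≫ adj i = 𝟙 K := toCLM_injective (by
    rw [toCLM_comp, toCLM_adj, toCLM_id]
    exact (ContinuousLinearMap.norm_map_iff_adjoint_comp_self _).1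
      ((AddMonoidHomClass.isometry_iff_norm _).1 hi))
  have hz : i ≫ f = 0 := toCLM_injective (by
    rw [toCLM_comp, toCLM_zero]
    ext x
    have : toCLM i x ∈ (toCLM f).ker := hr ▸ ⟨x, rfl⟩
    exact this)
  -- `kernel.ι f` takes its values in the range of `i`, on which `adj i ≫ i` is the identity
  have hι : kernel.ι f ≫ adj i ≫ i = kernel.ι f := toCLM_injective (by
    ext y
    have hy : toCLM (kernel.ι f) y ∈ (toCLM i).range := by
      rw [hr]
      have h := congrArg (fun φ => toCLM φ y) (kernel.condition f)
      rw [toCLM_comp, toCLM_zero] at h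
      exact h
    obtain ⟨z, hz⟩ := hy
    have hz : toCLM (kernel.ι f) y = toCLM i z := hz.symm
    rw [toCLM_comp, ContinuousLinearMap.comp_apply, hz, ← ContinuousLinearMap.comp_apply,
      ← toCLM_comp, ← Category.assoc, hadj, Category.id_comp])
  have hu : kernel.lift f i hz ≫ kernel.ι f = i := kernel.lift_ι _ _ _
  have hi' : adj i = adj (kernel.ι f) ≫ adj (kernel.lift f i hz) := by
    rw [← adj_comp, hu]
  have hc : ExtCat.coimι f ≫ adj i = 0 := by
    rw [hi', ← Category.assoc, ExtCat.coimι_adj, zero_comp]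
  have hs : (𝟙 X - adj i ≫ i) ≫ adj (kernel.ι f) = 0 := by
    have h : adj (kernel.ι f ≫ adj i ≫ i) = adj (kernel.ι f) := by rw [hι]
    rw [adj_comp, adj_comp, adj_adj] at h
    rw [Preadditive.sub_comp, Category.id_comp, h, sub_self]
  refine ⟨adj i ≫ kernel.lift f i hz, kernel.lift _ _ hs, ?_, ?_, ?_, ?_, ?_⟩
  · rw [← cancel_mono (kernel.ι f), Category.assoc, Category.assoc, hu, hι, Category.id_comp]
  · rw [← cancel_mono (ExtCat.coimι f), Category.assoc, kernel.lift_ι, Preadditive.comp_sub,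
      ← Category.assoc (ExtCat.coimι f) (adj i), hc, zero_comp, sub_zero, Category.comp_id,
      Category.id_comp]
  · rw [Category.assoc, hu, kernel.lift_ι, add_sub_cancel]
  · rw [← cancel_mono (ExtCat.coimι f), Category.assoc, kernel.lift_ι, Preadditive.comp_sub, hι,
      Category.comp_id, sub_self, zero_comp]
  · rw [← Category.assoc, hc, zero_comp]

/-- The decomposition of `exists_kernel_splitting`, with the kernel of `f` expressed as the kernel of
the composition of `f` with a monomorphism. -/
theorem exists_kernel_comp_splitting {X Y Z : C} (f : X ⟶ Y) (m : Y ⟶ Z) [Mono m] (g : X ⟶ Z)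
    (hg : f ≫ m = g) :
    ∃ (r : X ⟶ kernel g) (s : X ⟶ kernel (adj (kernel.ι f))),
      kernel.ι g ≫ r = 𝟙 _ ∧ ExtCat.coimι f ≫ s = 𝟙 _ ∧
      r ≫ kernel.ι g + s ≫ ExtCat.coimι f = 𝟙 X ∧
      kernel.ι g ≫ s = 0 ∧ ExtCat.coimι f ≫ r = 0 := by
  obtain ⟨r, s, h₁, h₂, h₃, h₄, h₅⟩ := exists_kernel_splitting f
  subst hg
  let e := kernelCompMono f m
  have he : e.hom ≫ kernel.ι f = kernel.ι (f ≫ m) := by simp [e]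
  have he' : e.inv ≫ kernel.ι (f ≫ m) = kernel.ι f := by simp [e]
  refine ⟨r ≫ e.inv, s, ?_, h₂, ?_, ?_, ?_⟩
  · rw [← he, Category.assoc, reassoc_of% h₁, e.hom_inv_id]
  · rw [Category.assoc, he', h₃]
  · rw [← he, Category.assoc, h₄, comp_zero]
  · rw [reassoc_of% h₅, zero_comp]

end HilbertCategory

/-! ### Decomposition of a chain complex into complexes of length one -/

namespace HomologicalComplex

section ToDouble

variable {C : Type u} [Category.{v} C] [HasZeroMorphisms C] [HasZeroObject C]
  {ι : Type*} {c : ComplexShape ι} {X₀ X₁ : C} {f : X₀ ⟶ X₁} {i₀ i₁ : ι} (hi₀₁ : c.Rel i₀ i₁)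
  (h : i₀ ≠ i₁) {K : HomologicalComplex C c} (φ₀ : K.X i₀ ⟶ X₀) (φ₁ : K.X i₁ ⟶ X₁)
  (comm : φ₀ ≫ f = K.d i₀ i₁ ≫ φ₁) (hφ : ∀ k, c.Rel k i₀ → K.d k i₀ ≫ φ₀ = 0)

open scoped Classical in
/-- Constructor for morphisms to a homological complex `double f hi₀₁`. -/
def mkHomToDouble : K ⟶ double f hi₀₁ where
  f k :=
    if hk₀ : k = i₀ then
      eqToHom (by rw [hk₀]) ≫ φ₀ ≫ (doubleXIso₀ f hi₀₁).inv ≫ eqToHom (by rw [hk₀])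
    else if hk₁ : k = i₁ then
      eqToHom (by rw [hk₁]) ≫ φ₁ ≫ (doubleXIso₁ f hi₀₁ h).inv ≫ eqToHom (by rw [hk₁])
    else 0
  comm' k₀ k₁ hk := by
    by_cases h₁ : k₁ = i₁
    · subst h₁
      obtain rfl := c.prev_eq hk hi₀₁
      rw [dif_pos rfl, dif_neg h.symm, dif_pos rfl, double_d f hi₀₁ h]
      simp only [eqToHom_refl, Category.id_comp, Category.comp_id, Category.assoc,
        Iso.inv_hom_id_assoc]
      rw [reassoc_of% comm]
    · by_cases h₀ : k₁ = i₀
      · subst h₀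
        rw [double_d_eq_zero₁ _ _ _ _ h, comp_zero, dif_pos rfl, eqToHom_refl, Category.id_comp,
          reassoc_of% hφ k₀ hk, zero_comp]
      · exact (isZero_double_X f hi₀₁ k₁ h₀ h₁).eq_of_tgt _ _

theorem mkHomToDouble_f₀ :
    (mkHomToDouble hi₀₁ h φ₀ φ₁ comm hφ).f i₀ = φ₀ ≫ (doubleXIso₀ f hi₀₁).inv := by
  dsimp [mkHomToDouble]
  rw [if_pos rfl, Category.id_comp, Category.comp_id]

theorem mkHomToDouble_f₁ :
    (mkHomToDouble hi₀₁ h φ₀ φ₁ comm hφ).f i₁ = φ₁ ≫ (doubleXIso₁ f hi₀₁ h).inv := by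
  dsimp [mkHomToDouble]
  rw [dif_neg h.symm, if_pos rfl, Category.id_comp, Category.comp_id]

end ToDouble

/-- A chain complex `K` with splittings `K.X 0 ≅ Z 0` and `K.X (i + 1) ≅ Z (i + 1) ⊞ A i`, for which
the differential is the composition `K.X (i + 1) ⟶ A i ⟶ Z i ⟶ K.X i`, is the direct sum of the
complexes `A i ⟶ Z i` if it has finite length. -/
theorem exists_double_decomposition {C : Type u} [Category.{v} C] [Preadditive C] [HasZeroObject C]
    (K : ChainComplex C ℕ) {A Z : ℕ → C} (α : ∀ i, A i ⟶ Z i)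
    (z : ∀ i, Z i ⟶ K.X i) (r : ∀ i, K.X i ⟶ Z i)
    (c : ∀ i, A i ⟶ K.X (i + 1)) (s : ∀ i, K.X (i + 1) ⟶ A i)
    (hzr : ∀ i, z i ≫ r i = 𝟙 _) (hcs : ∀ i, c i ≫ s i = 𝟙 _)
    (hcr : ∀ i, c i ≫ r (i + 1) = 0) (hzs : ∀ i, z (i + 1) ≫ s i = 0)
    (total₀ : r 0 ≫ z 0 = 𝟙 _) (total : ∀ i, r (i + 1) ≫ z (i + 1) + s i ≫ c i = 𝟙 _)
    (hd : ∀ i, K.d (i + 1) i = s i ≫ α i ≫ z i) :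
    ∃ (φ : ∀ i, double (α i) (show (ComplexShape.down ℕ).Rel (i + 1) i from rfl) ⟶ K)
      (ψ : ∀ i, K ⟶ double (α i) (show (ComplexShape.down ℕ).Rel (i + 1) i from rfl)),
      (∀ i, φ i ≫ ψ i = 𝟙 _) ∧ (∀ i j, i ≠ j → φ i ≫ ψ j = 0) ∧
      ∀ M, (∀ i, M < i → IsZero (K.X i)) → ∑ i : Fin (M + 1), ψ i ≫ φ i = 𝟙 K := by
  have hne (i : ℕ) : i + 1 ≠ i := by omega
  have hrel (i : ℕ) : (ComplexShape.down ℕ).Rel (i + 1) i := rfl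
  let φ (i : ℕ) : double (α i) (hrel i) ⟶ K := mkHomFromDouble (hrel i) (hne i) (c i) (z i)
    (by rw [hd, reassoc_of% hcs]) (by
      rintro k rfl
      rw [hd, reassoc_of% hzs, zero_comp])
  let ψ (i : ℕ) : K ⟶ double (α i) (hrel i) := mkHomToDouble (hrel i) (hne i) (s i) (r i)
    (by rw [hd, Category.assoc, Category.assoc, hzr, Category.comp_id]) (by
      rintro k rfl
      rw [hd, Category.assoc, Category.assoc, hzs, comp_zero, comp_zero])
  have φ₀ (i : ℕ) : (φ i).f (i + 1) = (doubleXIso₀ _ (hrel i)).hom ≫ c i :=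
    mkHomFromDouble_f₀ _ _ _ _ _ _
  have φ₁ (i : ℕ) : (φ i).f i = (doubleXIso₁ _ (hrel i) (hne i)).hom ≫ z i :=
    mkHomFromDouble_f₁ _ _ _ _ _ _
  have ψ₀ (i : ℕ) : (ψ i).f (i + 1) = s i ≫ (doubleXIso₀ _ (hrel i)).inv :=
    mkHomToDouble_f₀ _ _ _ _ _ _
  have ψ₁ (i : ℕ) : (ψ i).f i = r i ≫ (doubleXIso₁ _ (hrel i) (hne i)).inv :=
    mkHomToDouble_f₁ _ _ _ _ _ _
  have hzero (i k : ℕ) (h₀ : k ≠ i + 1) (h₁ : k ≠ i) : IsZero ((double (α i) (hrel i)).X k) :=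
    isZero_double_X _ _ _ h₀ h₁
  refine ⟨φ, ψ, fun i => ?_, fun i j hij => ?_, fun M hM => ?_⟩
  · apply from_double_hom_ext
    · rw [comp_f, φ₀, ψ₀, Category.assoc, reassoc_of% hcs, Iso.hom_inv_id, id_f]
    · rw [comp_f, φ₁, ψ₁, Category.assoc, reassoc_of% hzr, Iso.hom_inv_id, id_f]
  · apply from_double_hom_ext
    · rcases eq_or_ne (i + 1) j with rfl | h
      · rw [comp_f, φ₀, ψ₁, Category.assoc, reassoc_of% hcr, zero_comp, comp_zero, zero_f]
      · exact (hzero j _ (by omega) h).eq_of_tgt _ _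
    · rcases eq_or_ne i (j + 1) with rfl | h
      · rw [comp_f, φ₁, ψ₀, Category.assoc, reassoc_of% hzs, zero_comp, comp_zero, zero_f]
      · exact (hzero j _ h hij).eq_of_tgt _ _
  · ext m
    by_cases hm : M < m
    · exact (hM m hm).eq_of_src _ _
    have hb (i : ℕ) : (ψ i ≫ φ i).f i = r i ≫ z i := by
      rw [comp_f, φ₁, ψ₁, Category.assoc, Iso.inv_hom_id_assoc]
    have ht (i : ℕ) : (ψ i ≫ φ i).f (i + 1) = s i ≫ c i := by
      rw [comp_f, φ₀, ψ₀, Category.assoc, Iso.inv_hom_id_assoc]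
    have ho (i : ℕ) (h₀ : m ≠ i + 1) (h₁ : m ≠ i) : (ψ i ≫ φ i).f m = 0 := by
      rw [comp_f, (hzero i m h₀ h₁).eq_of_tgt ((ψ i).f m) 0, zero_comp]
    have hsum : (∑ i : Fin (M + 1), ψ i ≫ φ i).f m = ∑ i : Fin (M + 1), (ψ i ≫ φ i).f m :=
      map_sum (HomologicalComplex.Hom.fAddMonoidHom m) _ _
    rw [hsum, id_f, Fin.sum_univ_eq_sum_range (fun i => (ψ i ≫ φ i).f m)]
    cases m with
    | zero =>
      rw [Finset.sum_eq_single 0, hb, total₀]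
      · intro i _ hi
        exact ho i (by omega) (by omega)
      · intro h
        exact absurd (Finset.mem_range.2 (by omega)) h
    | succ m =>
      rw [Finset.sum_eq_add (m + 1) m (by omega), hb, ht, total]
      · rintro i _ ⟨hi, hi'⟩
        exact ho i (by omega) (by omega)
      · intro h
        exact absurd (Finset.mem_range.2 (by omega)) h
      · intro h
        exact absurd (Finset.mem_range.2 (by omega)) h

end HomologicalComplex

namespace HilbertCategory

variable {C : Type u} [Category.{v} C] [HilbertCategory C]

/-- The complex `A' ⟶ A` of length one, in degrees `i + 1` and `i`, given by the injective
representative of the `i`-th extended homology of `K`. -/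
abbrev strand (K : ChainComplex C ℕ) (i : ℕ) : ChainComplex C ℕ :=
  double (ExtCat.homology K i).reduce.hom
    (show (ComplexShape.down ℕ).Rel (i + 1) i from rfl)

/-- A chain complex of finite length is the direct sum of its strands: in degree `i` it is the
sum of the cycles, which are the bottom of the `i`-th strand, and of their orthogonal complement,
which is the top of the strand below. -/
theorem exists_strand_decomposition (K : ChainComplex C ℕ) :
    ∃ (φ : ∀ i, strand K i ⟶ K) (ψ : ∀ i, K ⟶ strand K i),
      (∀ i, φ i ≫ ψ i = 𝟙 _) ∧ (∀ i j, i ≠ j → φ i ≫ ψ j = 0) ∧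
      ∀ M, (∀ i, M < i → IsZero (K.X i)) → ∑ i : Fin (M + 1), ψ i ≫ φ i = 𝟙 K := by
  let Z (i : ℕ) : C := kernel (K.d i (i - 1))
  let z (i : ℕ) : Z i ⟶ K.X i := kernel.ι _
  let l (i : ℕ) : K.X (i + 1) ⟶ Z i := kernel.lift _ (K.d (i + 1) i) (K.d_comp_d _ _ _)
  have hl (i : ℕ) : l i ≫ z i = K.d (i + 1) i := kernel.lift_ι _ _ _
  let A (i : ℕ) : C := kernel (adj (kernel.ι (l i)))
  let c (i : ℕ) : A i ⟶ K.X (i + 1) := ExtCat.coimι (l i)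
  have hz (i : ℕ) : z (i + 1) ≫ K.d (i + 1) i = 0 := kernel.condition _
  -- `0 - 1` is `0` in `ℕ`, so that in degree zero everything is a cycle
  have hz₀ : K.d 0 (0 - 1) = 0 := K.shape _ _ (by simp)
  -- the splitting in each positive degree
  have key (i : ℕ) : ∃ (r : K.X (i + 1) ⟶ Z (i + 1)) (s : K.X (i + 1) ⟶ A i),
      z (i + 1) ≫ r = 𝟙 _ ∧ c i ≫ s = 𝟙 _ ∧ r ≫ z (i + 1) + s ≫ c i = 𝟙 _ ∧
      z (i + 1) ≫ s = 0 ∧ c i ≫ r = 0 :=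
    exists_kernel_comp_splitting (l i) (z i) (K.d (i + 1) i) (hl i)
  choose r' s h₁ h₂ h₃ h₄ h₅ using key
  let r₀ : K.X 0 ⟶ Z 0 := kernel.lift _ (𝟙 _) (by rw [hz₀, comp_zero])
  have hr₀ : r₀ ≫ z 0 = 𝟙 _ := kernel.lift_ι _ _ _
  have hr₀' : z 0 ≫ r₀ = 𝟙 _ := by
    rw [← cancel_mono (z 0), Category.assoc, hr₀, Category.comp_id, Category.id_comp]
  obtain ⟨r, hr, hr'⟩ : ∃ r : ∀ i, K.X i ⟶ Z i, r 0 = r₀ ∧ ∀ i, r (i + 1) = r' i :=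
    ⟨fun i => match i with
      | 0 => r₀
      | i + 1 => r' i, rfl, fun _ => rfl⟩
  have hzr (i : ℕ) : z i ≫ r i = 𝟙 _ := by
    cases i with
    | zero => rw [hr, hr₀']
    | succ i => rw [hr', h₁]
  refine exists_double_decomposition K (A := A) (Z := Z) (fun i => c i ≫ l i) z r c s hzr h₂
    (fun i => by rw [hr', h₅]) h₄ (by rw [hr, hr₀]) (fun i => by rw [hr', h₃]) fun i => ?_
  -- the differential vanishes on the cycles
  rw [Category.assoc, hl, ← Category.assoc]
  have := congrArg (· ≫ K.d (i + 1) i) (h₃ i)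
  simp only [Preadditive.add_comp, Category.id_comp] at this
  rw [Category.assoc, hz, comp_zero, zero_add] at this
  exact this.symm

end HilbertCategory

/-! ### Elementary tensors and tensor products of morphisms -/

namespace HilbertTensor

variable {C₁ : Type u₁} [Category.{v₁} C₁] [HilbertCategory C₁]
  {C₂ : Type u₂} [Category.{v₂} C₂] [HilbertCategory C₂]
  {C₃ : Type u₃} [Category.{v₃} C₃] [HilbertCategory C₃]
  (T : HilbertTensor C₁ C₂ C₃)

/-- The elementary tensor `x ⊗ y` in the Hilbert space underlying `X ⊗ Y`. -/
def tmul {X : C₁} {Y : C₂} (x : space X) (y : space Y) : space ((T.functor.obj X).obj Y) :=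
  T.equiv X Y ((x ⊗ₜ[ℂ] y : space X ⊗[ℂ] space Y) : UniformSpace.Completion _)

theorem tmul_add_left {X : C₁} {Y : C₂} (x x' : space X) (y : space Y) :
    T.tmul (x + x') y = T.tmul x y + T.tmul x' y := by
  rw [tmul, TensorProduct.add_tmul, UniformSpace.Completion.coe_add, map_add, tmul, tmul]

theorem tmul_add_right {X : C₁} {Y : C₂} (x : space X) (y y' : space Y) :
    T.tmul x (y + y') = T.tmul x y + T.tmul x y' := by
  rw [tmul, TensorProduct.tmul_add, UniformSpace.Completion.coe_add, map_add, tmul, tmul]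

theorem inner_tmul {X : C₁} {Y : C₂} (x x' : space X) (y y' : space Y) :
    inner ℂ (T.tmul x y) (T.tmul x' y') = inner ℂ x x' * inner ℂ y y' := by
  rw [tmul, tmul, LinearIsometryEquiv.inner_map_map, UniformSpace.Completion.inner_coe,
    TensorProduct.inner_tmul]

theorem norm_tmul {X : C₁} {Y : C₂} (x : space X) (y : space Y) :
    ‖T.tmul x y‖ = ‖x‖ * ‖y‖ := by
  rw [tmul, LinearIsometryEquiv.norm_map, UniformSpace.Completion.norm_coe,
    TensorProduct.norm_tmul]

theorem continuous_tmul_left {X : C₁} {Y : C₂} (y : space Y) :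
    Continuous fun x : space X => T.tmul x y :=
  AddMonoidHomClass.continuous_of_bound
    (AddMonoidHom.mk' (fun x : space X => T.tmul x y) fun x x' => T.tmul_add_left x x' y) ‖y‖
    fun x => by
      rw [mul_comm]
      exact (T.norm_tmul x y).le

theorem map_app_tmul {X X' : C₁} (f : X ⟶ X') {Y : C₂} (x : space X) (y : space Y) :
    toCLM ((T.functor.map f).app Y) (T.tmul x y) = T.tmul (toCLM f x) y := by
  have := T.toCLM_map f (𝟙 Y) x y
  rw [CategoryTheory.Functor.map_id, Category.comp_id, toCLM_id] at this
  exact this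

theorem obj_map_tmul (X : C₁) {Y Y' : C₂} (g : Y ⟶ Y') (x : space X) (y : space Y) :
    toCLM ((T.functor.obj X).map g) (T.tmul x y) = T.tmul x (toCLM g y) := by
  have := T.toCLM_map (𝟙 X) g x y
  rw [CategoryTheory.Functor.map_id, NatTrans.id_app, Category.id_comp, toCLM_id] at this
  exact this

theorem hom_ext {X : C₁} {Y : C₂} {Z : C₃} {φ ψ : (T.functor.obj X).obj Y ⟶ Z}
    (h : ∀ (x : space X) (y : space Y), toCLM φ (T.tmul x y) = toCLM ψ (T.tmul x y)) :
    φ = ψ := by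
  rw [← sub_eq_zero]
  refine T.eq_zero _ fun x y => ?_
  have : toCLM (φ - ψ) = toCLM φ - toCLM ψ := (inclusion C₃).map_sub
  rw [this]
  exact sub_eq_zero.2 (h x y)

instance : T.functor.Additive where
  map_add {X X' f g} := by
    ext Y
    refine T.hom_ext fun x y => ?_
    rw [NatTrans.app_add, T.map_app_tmul, toCLM_add, toCLM_add, add_apply,
      add_apply, T.map_app_tmul, T.map_app_tmul, T.tmul_add_left]

instance (X : C₁) : (T.functor.obj X).Additive where
  map_add {Y Y' f g} := by
    refine T.hom_ext fun x y => ?_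
    rw [T.obj_map_tmul, toCLM_add, toCLM_add, add_apply, add_apply, T.obj_map_tmul, T.obj_map_tmul,
      T.tmul_add_right]

/-- A vector that is orthogonal to the elementary tensors is zero. -/
theorem eq_zero_of_inner_tmul {X : C₁} {Y : C₂} (z : space ((T.functor.obj X).obj Y))
    (h : ∀ (x : space X) (y : space Y), inner ℂ (T.tmul x y) z = 0) : z = 0 := by
  refine ext_inner_left ℂ fun t => ?_
  rw [inner_zero_right]
  obtain ⟨c, rfl⟩ := (T.equiv X Y).surjective t
  induction c using UniformSpace.Completion.induction_on with
  | hp =>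
    exact isClosed_eq ((T.equiv X Y).continuous.inner continuous_const) continuous_const
  | ih a =>
    induction a using TensorProduct.induction_on with
    | zero => rw [UniformSpace.Completion.coe_zero, map_zero, inner_zero_left]
    | tmul x y => exact h x y
    | add a b ha hb =>
      rw [UniformSpace.Completion.coe_add, map_add, inner_add_left, ha, hb, add_zero]

theorem adj_map_app {X X' : C₁} (f : X ⟶ X') (Y : C₂) :
    adj ((T.functor.map f).app Y) = (T.functor.map (adj f)).app Y := by
  refine T.hom_ext fun x y => ?_
  rw [← sub_eq_zero]
  refine T.eq_zero_of_inner_tmul _ fun x' y' => ?_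
  rw [inner_sub_right, toCLM_adj, ContinuousLinearMap.adjoint_inner_right, T.map_app_tmul,
    T.map_app_tmul, T.inner_tmul, T.inner_tmul, toCLM_adj,
    ContinuousLinearMap.adjoint_inner_right, sub_self]

/-- The tensor product of an injective morphism `α` with an identity is a monomorphism: the range of
the adjoint of `α` is dense, so that the adjoint of `α ⊗ 1` has dense range, too. -/
theorem mono_map_app {X X' : C₁} (α : X ⟶ X') (hα : Function.Injective (toCLM α)) (Y : C₂) :
    Mono ((T.functor.map α).app Y) := by
  refine Preadditive.mono_of_cancel_zero _ fun {W} w hw => ?_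
  have hw' : (T.functor.map (adj α)).app Y ≫ adj w = 0 := by
    rw [← T.adj_map_app, ← adj_comp, hw, adj_zero]
  have hd : DenseRange (toCLM (adj α)) := by
    rw [toCLM_adj]
    have h := ContinuousLinearMap.orthogonal_ker (toCLM α)
    rw [LinearMap.ker_eq_bot.2 hα, Submodule.bot_orthogonal_eq_top] at h
    exact Submodule.dense_iff_topologicalClosure_eq_top.2 h.symm
  have hz : adj w = 0 := by
    refine T.hom_ext fun x y => ?_
    rw [toCLM_zero, zero_apply]
    have hc : IsClosed {x : space X | toCLM (adj w) (T.tmul x y) = 0} :=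
      isClosed_eq ((toCLM (adj w)).continuous.comp (T.continuous_tmul_left y)) continuous_const
    refine hd.induction_on (p := fun x => toCLM (adj w) (T.tmul x y) = 0) x hc fun x => ?_
    have := congrArg (fun φ => toCLM φ (T.tmul x y)) hw'
    rw [toCLM_comp, toCLM_zero] at this
    rw [← T.map_app_tmul]
    exact this
  rw [← adj_adj w, hz, adj_zero]

end HilbertTensor

/-! ### Extended homology from pieces of a complex -/

namespace ExtCat

theorem nonempty_iso_of_arrow {C : Type u} [Category.{v} C] [Preadditive C] {X Y : ExtCat C}
    (a : X.src ≅ Y.src) (b : X.tgt ≅ Y.tgt) (h : X.hom ≫ b.hom = a.hom ≫ Y.hom) :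
    Nonempty (X ≅ Y) :=
  ⟨⟨homMk b.hom ⟨a.hom, h⟩, homMk b.inv ⟨a.inv, by
      rw [Iso.comp_inv_eq, Category.assoc, h, Iso.inv_hom_id_assoc]⟩,
    homMk_congr b.hom_inv_id, homMk_congr b.inv_hom_id⟩⟩

theorem isZero_of_tgt {C : Type u} [Category.{v} C] [Preadditive C] {X : ExtCat C}
    (h : IsZero X.tgt) : IsZero X := by
  rw [IsZero.iff_id_eq_zero, id_eq, homMk_eq_zero_iff]
  exact ⟨0, h.eq_of_src _ _⟩

variable {C : Type u} [Category.{v} C] [HilbertCategory C] (K : ChainComplex C ℕ) (n : ℕ)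

theorem isZero_homology_of_mono [Mono (K.d n (n - 1))] : IsZero (homology K n) :=
  isZero_of_tgt (isZero_kernel_of_mono _)

theorem isZero_homology_of_isZero (h : IsZero (K.X n)) : IsZero (homology K n) :=
  have hz : IsZero (kernel (K.d n (n - 1))) := (IsZero.iff_id_eq_zero _).2
    (zero_of_comp_mono (kernel.ι (K.d n (n - 1))) (h.eq_of_tgt _ _))
  isZero_of_tgt hz

/-- The extended homology computed with an isomorphic piece of the complex. -/
theorem nonempty_homology_iso_of_ladder {P Q R : C} {f : P ⟶ Q} {g : Q ⟶ R} (w : f ≫ g = 0)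
    (p : P ≅ K.X (n + 1)) (q : Q ≅ K.X n) (r : R ≅ K.X (n - 1))
    (hp : f ≫ q.hom = p.hom ≫ K.d (n + 1) n) (hq : g ≫ r.hom = q.hom ≫ K.d n (n - 1)) :
    Nonempty (homology K n ≅ ⟨kernel.lift g f w⟩) := by
  obtain ⟨e⟩ := nonempty_iso_of_arrow (X := ⟨kernel.lift g f w⟩) (Y := homology K n) p
    (kernel.mapIso g (K.d n (n - 1)) q r hq) (by
      change kernel.lift g f w ≫ kernel.map g (K.d n (n - 1)) q.hom r.hom hq =
        p.hom ≫ kernel.lift _ _ _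
      rw [← cancel_mono (kernel.ι (K.d n (n - 1)))]
      simp [hp])
  exact ⟨e.symm⟩

/-- In a degree where all elements are cycles the extended homology is the differential. -/
theorem nonempty_homology_iso_of_d_eq_zero {P Q : C} {f : P ⟶ Q} (hd : K.d n (n - 1) = 0)
    (p : P ≅ K.X (n + 1)) (q : Q ≅ K.X n) (hp : f ≫ q.hom = p.hom ≫ K.d (n + 1) n) :
    Nonempty (homology K n ≅ ⟨f⟩) := by
  have : IsIso (kernel.ι (K.d n (n - 1))) := by
    rw [hd]
    infer_instance
  let e : kernel (K.d n (n - 1)) ≅ K.X n := asIso (kernel.ι _)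
  exact nonempty_iso_of_arrow (X := homology K n) (Y := ⟨f⟩) p.symm
    (e ≪≫ q.symm) (by
      change kernel.lift _ _ _ ≫ kernel.ι _ ≫ q.inv = p.inv ≫ f
      rw [kernel.lift_ι_assoc, Iso.comp_inv_eq, Category.assoc, hp, Iso.inv_hom_id_assoc])

end ExtCat

namespace HilbertTensor

variable {C₁ : Type u₁} [Category.{v₁} C₁] [HilbertCategory C₁]
  {C₂ : Type u₂} [Category.{v₂} C₂] [HilbertCategory C₂]
  {C₃ : Type u₃} [Category.{v₃} C₃] [HilbertCategory C₃]
  (T : HilbertTensor C₁ C₂ C₃)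

section

variable (K : ChainComplex C₁ ℕ) (L : ChainComplex C₂ ℕ)

/-- The inclusion of the summand `K_p ⊗ L_q` of `(K ⊗ L)_m`. -/
def ιX (p q m : ℕ) (h : p + q = m) :
    (T.functor.obj (K.X p)).obj (L.X q) ⟶ (T.complex K L).X m :=
  HomologicalComplex.ιMapBifunctor K L T.functor (ComplexShape.down ℕ) p q m h

variable {K L} in
theorem complex_hom_ext {m : ℕ} {Z : C₃} {f g : (T.complex K L).X m ⟶ Z}
    (h : ∀ p q (hpq : p + q = m), T.ιX K L p q m hpq ≫ f = T.ιX K L p q m hpq ≫ g) : f = g :=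
  HomologicalComplex.mapBifunctor.hom_ext h

/-- The projection onto the summand `K_p ⊗ L_q` of `(K ⊗ L)_m`, where `m = p + q`. It vanishes on the
other summands. -/
def πX (p q m : ℕ) :
    (T.complex K L).X m ⟶ (T.functor.obj (K.X p)).obj (L.X q) :=
  HomologicalComplex.mapBifunctorDesc fun p' q' _ =>
    if h : p' = p ∧ q' = q then eqToHom (by rw [h.1, h.2]) else 0

theorem ιX_πX_self (p q m : ℕ) (h : p + q = m) :
    T.ιX K L p q m h ≫ T.πX K L p q m = 𝟙 _ := by
  refine (HomologicalComplex.ι_mapBifunctorDesc _ _ _ _).trans ?_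
  rw [dif_pos ⟨rfl, rfl⟩, eqToHom_refl]

theorem ιX_πX_ne (p q p' q' m : ℕ) (h : p' + q' = m) (hne : p' ≠ p) :
    T.ιX K L p' q' m h ≫ T.πX K L p q m = 0 := by
  refine (HomologicalComplex.ι_mapBifunctorDesc _ _ _ _).trans ?_
  rw [dif_neg fun h => hne h.1]

/-- The differential of `K`, on the summand `K_p ⊗ L_q` of the tensor product. -/
def dLeft (p q m : ℕ) : (T.functor.obj (K.X p)).obj (L.X q) ⟶ (T.complex K L).X m :=
  HomologicalComplex.mapBifunctor.d₁ K L T.functor (ComplexShape.down ℕ) p q m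

/-- The differential of `L`, with its sign, on the summand `K_p ⊗ L_q` of the tensor product. -/
def dRight (p q m : ℕ) : (T.functor.obj (K.X p)).obj (L.X q) ⟶ (T.complex K L).X m :=
  HomologicalComplex.mapBifunctor.d₂ K L T.functor (ComplexShape.down ℕ) p q m

theorem ιX_d (p q m : ℕ) (h : p + q = m) (m' : ℕ) :
    T.ιX K L p q m h ≫ (T.complex K L).d m m' =
      T.dLeft K L p q m' + T.dRight K L p q m' := by
  refine (congrArg (T.ιX K L p q m h ≫ ·)
    (HomologicalComplex.mapBifunctor.d_eq K L T.functor (ComplexShape.down ℕ) m m')).trans ?_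
  refine (Preadditive.comp_add _ _ _ _ _ _).trans ?_
  congr 1
  · exact HomologicalComplex.mapBifunctor.ι_D₁ K L T.functor (ComplexShape.down ℕ) m m' p q h
  · exact HomologicalComplex.mapBifunctor.ι_D₂ K L T.functor (ComplexShape.down ℕ) m m' p q h

theorem dLeft_succ (p q m : ℕ) (h : p + q = m) :
    T.dLeft K L (p + 1) q m =
      (T.functor.map (K.d (p + 1) p)).app (L.X q) ≫ T.ιX K L p q m h := by
  refine (HomologicalComplex.mapBifunctor.d₁_eq K L T.functor (ComplexShape.down ℕ)
    (i₁ := p + 1) (i₁' := p) rfl q m h).trans ?_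
  exact one_smul ℤˣ _

theorem dRight_succ (p q m : ℕ) (h : p + q = m) :
    T.dRight K L p (q + 1) m =
      ((-1 : ℤˣ) ^ p) • ((T.functor.obj (K.X p)).map (L.d (q + 1) q) ≫ T.ιX K L p q m h) :=
  HomologicalComplex.mapBifunctor.d₂_eq K L T.functor (ComplexShape.down ℕ) p
    (i₂ := q + 1) (i₂' := q) rfl m h

theorem dLeft_eq_zero (p q m : ℕ) (h : ∀ p', p' + 1 = p → IsZero (K.X p')) :
    T.dLeft K L p q m = 0 := by
  unfold dLeft
  by_cases hp : (ComplexShape.down ℕ).Rel p ((ComplexShape.down ℕ).next p)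
  · rw [HomologicalComplex.mapBifunctor.d₁_eq' K L T.functor (ComplexShape.down ℕ) hp,
      (h _ hp).eq_of_tgt (K.d p _) 0, Functor.map_zero, zero_app, zero_comp, smul_zero]
    rfl
  · exact HomologicalComplex.mapBifunctor.d₁_eq_zero K L T.functor (ComplexShape.down ℕ) p q m hp

theorem dRight_eq_zero (p q m : ℕ) (h : ∀ q', q' + 1 = q → IsZero (L.X q')) :
    T.dRight K L p q m = 0 := by
  unfold dRight
  by_cases hq : (ComplexShape.down ℕ).Rel q ((ComplexShape.down ℕ).next q)
  · rw [HomologicalComplex.mapBifunctor.d₂_eq' K L T.functor (ComplexShape.down ℕ) p hq,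
      (h _ hq).eq_of_tgt (L.d q _) 0, Functor.map_zero, zero_comp, smul_zero]
    rfl
  · exact HomologicalComplex.mapBifunctor.d₂_eq_zero K L T.functor (ComplexShape.down ℕ) p q m hq

theorem isZero_obj_left {X : C₁} (h : IsZero X) (Y : C₂) :
    IsZero ((T.functor.obj X).obj Y) := by
  rw [IsZero.iff_id_eq_zero] at h ⊢
  rw [← NatTrans.id_app, ← CategoryTheory.Functor.map_id, h, Functor.map_zero, zero_app]

theorem isZero_obj_right (X : C₁) {Y : C₂} (h : IsZero Y) :
    IsZero ((T.functor.obj X).obj Y) :=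
  (T.functor.obj X).map_isZero h

theorem isZero_complex_X (m : ℕ)
    (h : ∀ p q, p + q = m → IsZero (K.X p) ∨ IsZero (L.X q)) : IsZero ((T.complex K L).X m) := by
  rw [IsZero.iff_id_eq_zero]
  refine T.complex_hom_ext fun p q hpq => ?_
  rcases h p q hpq with h | h
  · exact (T.isZero_obj_left h _).eq_of_src _ _
  · exact (T.isZero_obj_right _ h).eq_of_src _ _

end

section TwoTerm

variable {K : ChainComplex C₁ ℕ} {L : ChainComplex C₂ ℕ} {i j : ℕ}

/-- For `K` and `L` concentrated in two successive degrees, at most four summands of `K ⊗ L` matter. -/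
theorem complex_hom_ext_of_two_term
    (hK : ∀ p, p ≠ i + 1 → p ≠ i → IsZero (K.X p))
    (hL : ∀ q, q ≠ j + 1 → q ≠ j → IsZero (L.X q)) {m : ℕ} {Z : C₃} {f g : (T.complex K L).X m ⟶ Z}
    (h : ∀ p q (hpq : p + q = m), (p = i + 1 ∨ p = i) → (q = j + 1 ∨ q = j) →
      T.ιX K L p q m hpq ≫ f = T.ιX K L p q m hpq ≫ g) : f = g := by
  refine T.complex_hom_ext fun p q hpq => ?_
  by_cases hp : p = i + 1 ∨ p = i
  · by_cases hq : q = j + 1 ∨ q = j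
    · exact h p q hpq hp hq
    · rw [not_or] at hq
      exact (T.isZero_obj_right _ (hL q hq.1 hq.2)).eq_of_src _ _
  · rw [not_or] at hp
    exact (T.isZero_obj_left (hK p hp.1 hp.2) _).eq_of_src _ _

variable (hK : ∀ p, p ≠ i + 1 → p ≠ i → IsZero (K.X p))
  (hL : ∀ q, q ≠ j + 1 → q ≠ j → IsZero (L.X q))

/-- The tensor product of two complexes of length one, in its lowest degree. -/
def bottomIso : (T.functor.obj (K.X i)).obj (L.X j) ≅ (T.complex K L).X (i + j) where
  hom := T.ιX K L i j _ rfl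
  inv := T.πX K L i j _
  hom_inv_id := T.ιX_πX_self K L i j _ rfl
  inv_hom_id := by
    refine T.complex_hom_ext_of_two_term hK hL fun p q hpq hp hq => ?_
    obtain rfl : p = i := by omega
    obtain rfl : q = j := by omega
    rw [Category.comp_id, ← Category.assoc, ιX_πX_self, Category.id_comp]

/-- The tensor product of two complexes of length one, in its middle degree. The sign `(-1) ^ i`
accounts for the sign in the differential. -/
def middleIso : (T.functor.obj (K.X (i + 1))).obj (L.X j) ⊞
    (T.functor.obj (K.X i)).obj (L.X (j + 1)) ≅ (T.complex K L).X (i + j + 1) where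
  hom := biprod.desc (T.ιX K L (i + 1) j _ (by omega))
    (((-1 : ℤˣ) ^ i) • T.ιX K L i (j + 1) _ (by omega))
  inv := biprod.lift (T.πX K L (i + 1) j _) (((-1 : ℤˣ) ^ i) • T.πX K L i (j + 1) _)
  hom_inv_id := by
    have hs : ((-1 : ℤˣ) ^ i) * (-1) ^ i = 1 := Int.units_mul_self _
    apply biprod.hom_ext' <;> apply biprod.hom_ext <;>
      simp [ιX_πX_self, ιX_πX_ne, Linear.comp_units_smul, Linear.units_smul_comp, smul_smul, hs]
  inv_hom_id := by
    have hs : ((-1 : ℤˣ) ^ i) * (-1) ^ i = 1 := Int.units_mul_self _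
    refine T.complex_hom_ext_of_two_term hK hL fun p q hpq hp hq => ?_
    rw [biprod.lift_desc, Linear.comp_units_smul, Linear.units_smul_comp, smul_smul, hs, one_smul,
      Preadditive.comp_add, Category.comp_id, ← Category.assoc, ← Category.assoc]
    rcases hp with rfl | rfl
    · obtain rfl : q = j := by omega
      rw [ιX_πX_self, ιX_πX_ne _ _ _ _ _ _ _ _ _ (by omega), zero_comp, add_zero,
        Category.id_comp]
    · obtain rfl : q = j + 1 := by omega
      rw [ιX_πX_self, ιX_πX_ne _ _ _ _ _ _ _ _ _ (by omega), zero_comp, zero_add,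
        Category.id_comp]

/-- The tensor product of two complexes of length one, in its highest degree. -/
def topIso : (T.functor.obj (K.X (i + 1))).obj (L.X (j + 1)) ≅
    (T.complex K L).X (i + j + 1 + 1) where
  hom := ((-1 : ℤˣ) ^ i) • T.ιX K L (i + 1) (j + 1) _ (by omega)
  inv := ((-1 : ℤˣ) ^ i) • T.πX K L (i + 1) (j + 1) _
  hom_inv_id := by
    rw [Linear.comp_units_smul, Linear.units_smul_comp, smul_smul, Int.units_mul_self, one_smul,
      ιX_πX_self]
  inv_hom_id := by
    refine T.complex_hom_ext_of_two_term hK hL fun p q hpq hp hq => ?_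
    obtain rfl : p = i + 1 := by omega
    obtain rfl : q = j + 1 := by omega
    rw [Linear.comp_units_smul, Linear.units_smul_comp, smul_smul, Int.units_mul_self, one_smul,
      Category.comp_id, ← Category.assoc, ιX_πX_self, Category.id_comp]

theorem d₁_bottomIso : T.d₁ (K.d (i + 1) i) (L.d (j + 1) j) ≫ (T.bottomIso hK hL).hom =
    (T.middleIso hK hL).hom ≫ (T.complex K L).d (i + j + 1) (i + j) := by
  have hs : ((-1 : ℤˣ) ^ i) * (-1) ^ i = 1 := Int.units_mul_self _
  apply biprod.hom_ext'
  · simp only [d₁, middleIso, bottomIso, biprod.inl_desc_assoc]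
    rw [ιX_d, T.dLeft_succ K L i j _ rfl, T.dRight_eq_zero, add_zero]
    intro q hq
    exact hL q (by omega) (by omega)
  · simp only [d₁, middleIso, bottomIso, biprod.inr_desc_assoc]
    rw [Linear.units_smul_comp, ιX_d, T.dRight_succ K L i j _ rfl, T.dLeft_eq_zero, zero_add, smul_smul,
      hs, one_smul]
    intro p hp
    exact hK p (by omega) (by omega)

theorem d₂_middleIso : T.d₂ (K.d (i + 1) i) (L.d (j + 1) j) ≫ (T.middleIso hK hL).hom =
    (T.topIso hK hL).hom ≫ (T.complex K L).d (i + j + 1 + 1) (i + j + 1) := by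
  simp only [d₂, middleIso, topIso, biprod.lift_desc]
  rw [Linear.units_smul_comp, ιX_d, T.dLeft_succ K L i (j + 1) _ (by omega),
    T.dRight_succ K L (i + 1) j _ (by omega), smul_add, smul_smul, pow_succ, mul_neg_one, mul_neg,
    Int.units_mul_self, Linear.comp_units_smul, Preadditive.neg_comp]
  refine (add_comm _ _).trans (congrArg _ ?_)
  rw [Units.smul_def]
  simp

end TwoTerm

end HilbertTensor

/-! ### Tensor products of two complexes of length one -/

namespace HilbertTensor

variable {C₁ : Type u₁} [Category.{v₁} C₁] [HilbertCategory C₁]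
  {C₂ : Type u₂} [Category.{v₂} C₂] [HilbertCategory C₂]
  {C₃ : Type u₃} [Category.{v₃} C₃] [HilbertCategory C₃]
  (T : HilbertTensor C₁ C₂ C₃)

/-- The tensor product of two isomorphisms. -/
def objIso {X X' : C₁} {Y Y' : C₂} (a : X ≅ X') (b : Y ≅ Y') :
    (T.functor.obj X).obj Y ≅ (T.functor.obj X').obj Y' :=
  (T.functor.mapIso a).app Y ≪≫ (T.functor.obj X').mapIso b

section

variable {A' A : C₁} {B' B : C₂} {α : A' ⟶ A} {β : B' ⟶ B}
  {P' P : C₁} {Q' Q : C₂} {γ : P' ⟶ P} {δ : Q' ⟶ Q}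
  (a' : A' ≅ P') (a : A ≅ P) (b' : B' ≅ Q') (b : B ≅ Q)

theorem map_app_objIso (hα : α ≫ a.hom = a'.hom ≫ γ) :
    (T.functor.map α).app B ≫ (T.objIso a b).hom =
      (T.objIso a' b).hom ≫ (T.functor.map γ).app Q := by
  simp only [objIso, Iso.trans_hom, Iso.app_hom, Functor.mapIso_hom, Category.assoc,
    NatTrans.naturality]
  rw [← NatTrans.comp_app_assoc, ← Functor.map_comp, hα, Functor.map_comp, NatTrans.comp_app_assoc]

theorem obj_map_objIso (hβ : β ≫ b.hom = b'.hom ≫ δ) :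
    (T.functor.obj A).map β ≫ (T.objIso a b).hom =
      (T.objIso a b').hom ≫ (T.functor.obj P).map δ := by
  simp only [objIso, Iso.trans_hom, Iso.app_hom, Functor.mapIso_hom, Category.assoc]
  rw [NatTrans.naturality_assoc, ← Functor.map_comp, hβ, Functor.map_comp]

theorem d₁_objIso (hα : α ≫ a.hom = a'.hom ≫ γ) (hβ : β ≫ b.hom = b'.hom ≫ δ) :
    T.d₁ α β ≫ (T.objIso a b).hom =
      (biprod.mapIso (T.objIso a' b) (T.objIso a b')).hom ≫ T.d₁ γ δ := by
  apply biprod.hom_ext'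
  · simpa [d₁] using T.map_app_objIso a' a b hα
  · simpa [d₁] using T.obj_map_objIso a b' b hβ

theorem d₂_objIso (hα : α ≫ a.hom = a'.hom ≫ γ) (hβ : β ≫ b.hom = b'.hom ≫ δ) :
    T.d₂ α β ≫ (biprod.mapIso (T.objIso a' b) (T.objIso a b')).hom =
      (T.objIso a' b').hom ≫ T.d₂ γ δ := by
  apply biprod.hom_ext
  · simpa [d₂] using T.obj_map_objIso a' b' b hβ
  · simpa [d₂] using T.map_app_objIso a' a b' hα

end

section Double

variable {A' A : C₁} {B' B : C₂} (α : A' ⟶ A) (β : B' ⟶ B) {i j : ℕ}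
  (hi : (ComplexShape.down ℕ).Rel (i + 1) i) (hj : (ComplexShape.down ℕ).Rel (j + 1) j)

theorem nonempty_homology_double_bottom :
    Nonempty (ExtCat.homology (T.complex (double α hi) (double β hj)) (i + j) ≅
      ⟨T.d₁ α β⟩) := by
  have hK := fun p => isZero_double_X α hi p
  have hL := fun q => isZero_double_X β hj q
  have hi' : i + 1 ≠ i := by omega
  have hj' : j + 1 ≠ j := by omega
  have hd : (T.complex (double α hi) (double β hj)).d (i + j) (i + j - 1) = 0 := by
    by_cases h : i + j = 0
    · exact HomologicalComplex.shape _ _ _ (by simp [h])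
    · refine IsZero.eq_of_tgt (T.isZero_complex_X _ _ _ fun p q hpq => ?_) _ _
      by_cases hp : p = i + 1 ∨ p = i
      · exact Or.inr (hL q (by omega) (by omega))
      · exact Or.inl (hK p (by omega) (by omega))
  refine ExtCat.nonempty_homology_iso_of_d_eq_zero _ _ hd
    (biprod.mapIso (T.objIso (doubleXIso₀ α hi).symm (doubleXIso₁ β hj hj').symm)
      (T.objIso (doubleXIso₁ α hi hi').symm (doubleXIso₀ β hj).symm) ≪≫ T.middleIso hK hL)
    (T.objIso (doubleXIso₁ α hi hi').symm (doubleXIso₁ β hj hj').symm ≪≫ T.bottomIso hK hL) ?_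
  rw [Iso.trans_hom, Iso.trans_hom, Category.assoc, ← T.d₁_bottomIso, ← Category.assoc,
    T.d₁_objIso (γ := (double α hi).d (i + 1) i) (δ := (double β hj).d (j + 1) j)
      (doubleXIso₀ α hi).symm _ (doubleXIso₀ β hj).symm _, Category.assoc]
  · simp [double_d α hi hi']
  · simp [double_d β hj hj']

theorem nonempty_homology_double_middle :
    Nonempty (ExtCat.homology (T.complex (double α hi) (double β hj)) (i + j + 1) ≅
      ⟨kernel.lift (T.d₁ α β) (T.d₂ α β) (T.d₂_d₁ α β)⟩) := by
  have hK := fun p => isZero_double_X α hi p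
  have hL := fun q => isZero_double_X β hj q
  have hi' : i + 1 ≠ i := by omega
  have hj' : j + 1 ≠ j := by omega
  have hα : α ≫ (doubleXIso₁ α hi hi').symm.hom =
      (doubleXIso₀ α hi).symm.hom ≫ (double α hi).d (i + 1) i := by
    simp [double_d α hi hi']
  have hβ : β ≫ (doubleXIso₁ β hj hj').symm.hom =
      (doubleXIso₀ β hj).symm.hom ≫ (double β hj).d (j + 1) j := by
    simp [double_d β hj hj']
  refine ExtCat.nonempty_homology_iso_of_ladder _ _ _
    (T.objIso (doubleXIso₀ α hi).symm (doubleXIso₀ β hj).symm ≪≫ T.topIso hK hL)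
    (biprod.mapIso (T.objIso (doubleXIso₀ α hi).symm (doubleXIso₁ β hj hj').symm)
      (T.objIso (doubleXIso₁ α hi hi').symm (doubleXIso₀ β hj).symm) ≪≫ T.middleIso hK hL)
    (T.objIso (doubleXIso₁ α hi hi').symm (doubleXIso₁ β hj hj').symm ≪≫ T.bottomIso hK hL) ?_ ?_
  · rw [Iso.trans_hom, Iso.trans_hom, Category.assoc, ← T.d₂_middleIso, ← Category.assoc,
      T.d₂_objIso _ _ _ _ hα hβ, Category.assoc]
  · rw [Iso.trans_hom, Iso.trans_hom, Category.assoc]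
    refine Eq.trans ?_ (congrArg _ (T.d₁_bottomIso hK hL))
    rw [← Category.assoc, T.d₁_objIso _ _ _ _ hα hβ, Category.assoc]

/-- The extended homology of the tensor product of two injective complexes of length one is
concentrated in the two lowest degrees. -/
theorem isZero_homology_double (hα : Function.Injective (toCLM α)) (n : ℕ) (h₀ : i + j ≠ n)
    (h₁ : i + j + 1 ≠ n) :
    IsZero (ExtCat.homology (T.complex (double α hi) (double β hj)) n) := by
  have hK := fun p => isZero_double_X α hi p
  have hL := fun q => isZero_double_X β hj q
  have hi' : i + 1 ≠ i := by omega
  by_cases h₂ : n = i + j + 1 + 1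
  · subst h₂
    have hm : Mono ((T.functor.map ((double α hi).d (i + 1) i)).app
        ((double β hj).X (j + 1))) := by
      have := T.mono_map_app α hα ((double β hj).X (j + 1))
      rw [double_d α hi hi', Functor.map_comp, Functor.map_comp, NatTrans.comp_app,
        NatTrans.comp_app]
      infer_instance
    have hm₂ : Mono (T.d₂ ((double α hi).d (i + 1) i) ((double β hj).d (j + 1) j)) := by
      have hs : T.d₂ ((double α hi).d (i + 1) i) ((double β hj).d (j + 1) j) ≫ biprod.snd =
          (T.functor.map ((double α hi).d (i + 1) i)).app ((double β hj).X (j + 1)) :=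
        biprod.lift_snd _ _
      exact mono_of_mono_fac hs
    have hm₃ : Mono ((T.complex (double α hi) (double β hj)).d (i + j + 1 + 1)
        (i + j + 1 + 1 - 1)) := by
      change Mono ((T.complex (double α hi) (double β hj)).d (i + j + 1 + 1) (i + j + 1))
      have h : (T.complex (double α hi) (double β hj)).d (i + j + 1 + 1) (i + j + 1) =
          (T.topIso hK hL).inv ≫ T.d₂ ((double α hi).d (i + 1) i) ((double β hj).d (j + 1) j) ≫
            (T.middleIso hK hL).hom := by
        rw [T.d₂_middleIso, Iso.inv_hom_id_assoc]
      rw [h]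
      infer_instance
    exact ExtCat.isZero_homology_of_mono _ (i + j + 1 + 1)
  · refine ExtCat.isZero_homology_of_isZero _ _ (T.isZero_complex_X _ _ _ fun p q hpq => ?_)
    by_cases hp : p = i + 1 ∨ p = i
    · exact Or.inr (hL q (by omega) (by omega))
    · exact Or.inl (hK p (by omega) (by omega))

end Double

end HilbertTensor

/-! ### Direct sum decompositions and functors of two variables -/

/-- A direct sum decomposition with index set `S` can be rewritten as a direct sum over two index
sets `A` and `B` that together parametrize the nonzero summands. -/
theorem nonempty_iso_biprod_of_total {D : Type u} [Category.{v} D] [Preadditive D]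
    [HasFiniteBiproducts D] [HasBinaryBiproducts D] {X : D} {S : Type*} [Fintype S] (M : S → D)
    (p : ∀ s, X ⟶ M s) (q : ∀ s, M s ⟶ X) (hqp : ∀ s, q s ≫ p s = 𝟙 _)
    (hne : ∀ s t, s ≠ t → q s ≫ p t = 0) (total : ∑ s, p s ≫ q s = 𝟙 X)
    {A B : Type} [Finite A] [Finite B] {P : A → D} {Q : B → D} (eA : A → S) (eB : B → S)
    (hA : Function.Injective eA) (hB : Function.Injective eB) (hAB : ∀ a b, eA a ≠ eB b)
    (iA : ∀ a, M (eA a) ≅ P a) (iB : ∀ b, M (eB b) ≅ Q b)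
    (hz : ∀ s, (∀ a, eA a ≠ s) → (∀ b, eB b ≠ s) → IsZero (M s)) :
    Nonempty (X ≅ (⨁ P) ⊞ ⨁ Q) := by
  classical
  cases nonempty_fintype A
  cases nonempty_fintype B
  let fA : X ⟶ ⨁ P := biproduct.lift fun a => p (eA a) ≫ (iA a).hom
  let fB : X ⟶ ⨁ Q := biproduct.lift fun b => p (eB b) ≫ (iB b).hom
  let gA : ⨁ P ⟶ X := biproduct.desc fun a => (iA a).inv ≫ q (eA a)
  let gB : ⨁ Q ⟶ X := biproduct.desc fun b => (iB b).inv ≫ q (eB b)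
  have hAA : gA ≫ fA = 𝟙 _ := by
    refine biproduct.hom_ext' _ _ fun a => biproduct.hom_ext _ _ fun a' => ?_
    rcases eq_or_ne a a' with rfl | h
    · simp [gA, fA, reassoc_of% hqp]
    · simp [gA, fA, reassoc_of% hne _ _ (hA.ne h), biproduct.ι_π_ne _ h]
  have hBB : gB ≫ fB = 𝟙 _ := by
    refine biproduct.hom_ext' _ _ fun b => biproduct.hom_ext _ _ fun b' => ?_
    rcases eq_or_ne b b' with rfl | h
    · simp [gB, fB, reassoc_of% hqp]
    · simp [gB, fB, reassoc_of% hne _ _ (hB.ne h), biproduct.ι_π_ne _ h]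
  have hBA : gA ≫ fB = 0 := by
    refine biproduct.hom_ext' _ _ fun a => biproduct.hom_ext _ _ fun b => ?_
    simp [gA, fB, reassoc_of% hne _ _ (hAB a b)]
  have hAB' : gB ≫ fA = 0 := by
    refine biproduct.hom_ext' _ _ fun b => biproduct.hom_ext _ _ fun a => ?_
    simp [gB, fA, reassoc_of% hne _ _ (hAB a b).symm]
  have htot : fA ≫ gA + fB ≫ gB = 𝟙 X := by
    rw [← total]
    simp only [fA, fB, gA, gB, biproduct.lift_desc, Category.assoc, Iso.hom_inv_id_assoc]
    let e : A ⊕ B → S := Sum.elim eA eB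
    have he : Function.Injective e := hA.sumElim hB hAB
    rw [← Fintype.sum_of_injective e he (fun x => p (e x) ≫ q (e x)) (fun s => p s ≫ q s) ?_
      fun _ => rfl, Fintype.sum_sum_type]
    · rfl
    · intro s hs
      have hs' : IsZero (M s) := hz s (fun a ha => hs ⟨Sum.inl a, ha⟩)
        (fun b hb => hs ⟨Sum.inr b, hb⟩)
      rw [hs'.eq_of_tgt (p s) 0, zero_comp]
  refine ⟨⟨biprod.lift fA fB, biprod.desc gA gB, ?_, ?_⟩⟩
  · rw [biprod.lift_desc, htot]
  · apply biprod.hom_ext' <;> apply biprod.hom_ext <;> simp [hAA, hBB, hBA, hAB']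

/-- An additive functor of two variables takes direct sum decompositions of `X` and `Y` to the
direct sum decomposition indexed by pairs. -/
theorem exists_total_of_biadditive {D₁ : Type*} [Category* D₁] [Preadditive D₁]
    {D₂ : Type*} [Category* D₂] [Preadditive D₂] {D : Type*} [Category* D] [Preadditive D]
    (F : D₁ ⥤ D₂ ⥤ D) [F.Additive] [∀ X, (F.obj X).Additive]
    {I J : Type} [Fintype I] [Fintype J] {X : D₁} {Y : D₂} {M : I → D₁} {N : J → D₂}
    (φ : ∀ i, M i ⟶ X) (ψ : ∀ i, X ⟶ M i) (φ' : ∀ j, N j ⟶ Y) (ψ' : ∀ j, Y ⟶ N j)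
    (h : ∀ i, φ i ≫ ψ i = 𝟙 _) (hne : ∀ i i', i ≠ i' → φ i ≫ ψ i' = 0)
    (total : ∑ i, ψ i ≫ φ i = 𝟙 X)
    (h' : ∀ j, φ' j ≫ ψ' j = 𝟙 _) (hne' : ∀ j j', j ≠ j' → φ' j ≫ ψ' j' = 0)
    (total' : ∑ j, ψ' j ≫ φ' j = 𝟙 Y) :
    ∃ (p : ∀ s : I × J, (F.obj X).obj Y ⟶ (F.obj (M s.1)).obj (N s.2))
      (q : ∀ s : I × J, (F.obj (M s.1)).obj (N s.2) ⟶ (F.obj X).obj Y),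
      (∀ s, q s ≫ p s = 𝟙 _) ∧ (∀ s t, s ≠ t → q s ≫ p t = 0) ∧ ∑ s, p s ≫ q s = 𝟙 _ := by
  have hqp (s t : I × J) : ((F.obj (M s.1)).map (φ' s.2) ≫ (F.map (φ s.1)).app Y) ≫
      (F.map (ψ t.1)).app Y ≫ (F.obj (M t.1)).map (ψ' t.2) =
      (F.obj (M s.1)).map (φ' s.2 ≫ ψ' t.2) ≫ (F.map (φ s.1 ≫ ψ t.1)).app (N t.2) := by
    simp only [Functor.map_comp, NatTrans.comp_app, Category.assoc]
    rw [← NatTrans.naturality, ← NatTrans.naturality_assoc]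
  refine ⟨fun s => (F.map (ψ s.1)).app Y ≫ (F.obj (M s.1)).map (ψ' s.2),
    fun s => (F.obj (M s.1)).map (φ' s.2) ≫ (F.map (φ s.1)).app Y, fun s => ?_,
    fun s t hst => ?_, ?_⟩
  · rw [hqp, h, h', CategoryTheory.Functor.map_id, CategoryTheory.Functor.map_id, NatTrans.id_app,
      Category.id_comp]
  · rw [hqp]
    by_cases h₁ : s.1 = t.1
    · rw [hne' _ _ fun h₂ => hst (Prod.ext h₁ h₂), Functor.map_zero, zero_comp]
    · rw [hne _ _ h₁, Functor.map_zero, zero_app, comp_zero]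
  · rw [Fintype.sum_prod_type]
    have hrow (i : I) : ∑ j, ((F.map (ψ i)).app Y ≫ (F.obj (M i)).map (ψ' j)) ≫
        (F.obj (M i)).map (φ' j) ≫ (F.map (φ i)).app Y = (F.map (ψ i ≫ φ i)).app Y := by
      have : ∀ j, ((F.map (ψ i)).app Y ≫ (F.obj (M i)).map (ψ' j)) ≫
          (F.obj (M i)).map (φ' j) ≫ (F.map (φ i)).app Y =
          (F.map (ψ i)).app Y ≫ (F.obj (M i)).map (ψ' j ≫ φ' j) ≫ (F.map (φ i)).app Y := by
        intro j
        simp only [Functor.map_comp, Category.assoc]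
      simp only [this]
      rw [← Preadditive.comp_sum, ← Preadditive.sum_comp, ← Functor.map_sum, total',
        CategoryTheory.Functor.map_id, Category.id_comp, Functor.map_comp, NatTrans.comp_app]
    refine (Finset.sum_congr rfl fun i _ => hrow i).trans ?_
    rw [← NatTrans.app_sum, ← Functor.map_sum, total, CategoryTheory.Functor.map_id,
      NatTrans.id_app]

namespace HilbertTensor

variable {C₁ : Type u₁} [Category.{v₁} C₁] [HilbertCategory C₁]
  {C₂ : Type u₂} [Category.{v₂} C₂] [HilbertCategory C₂]
  {C₃ : Type u₃} [Category.{v₃} C₃] [HilbertCategory C₃]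
  (T : HilbertTensor C₁ C₂ C₃)

/-- The tensor product of chain complexes as a functor of two variables. -/
abbrev complexFunctor : ChainComplex C₁ ℕ ⥤ ChainComplex C₂ ℕ ⥤ ChainComplex C₃ ℕ :=
  T.functor.map₂HomologicalComplex (ComplexShape.down ℕ) (ComplexShape.down ℕ)
    (ComplexShape.down ℕ)

instance : T.complexFunctor.Additive where
  map_add {K K' f g} := by
    ext L : 2
    have h : mapBifunctorMap (f + g) (𝟙 L) T.functor (ComplexShape.down ℕ) =
        mapBifunctorMap f (𝟙 L) _ _ + mapBifunctorMap g (𝟙 L) _ _ := by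
      ext m : 1
      refine HomologicalComplex.mapBifunctor.hom_ext fun p q hpq => ?_
      rw [HomologicalComplex.add_f_apply, Preadditive.comp_add, ι_mapBifunctorMap,
        ι_mapBifunctorMap, ι_mapBifunctorMap, HomologicalComplex.add_f_apply, Functor.map_add,
        NatTrans.app_add, Preadditive.add_comp]
    exact h

instance (K : ChainComplex C₁ ℕ) : (T.complexFunctor.obj K).Additive where
  map_add {L L' f g} := by
    have h : mapBifunctorMap (𝟙 K) (f + g) T.functor (ComplexShape.down ℕ) =
        mapBifunctorMap (𝟙 K) f _ _ + mapBifunctorMap (𝟙 K) g _ _ := by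
      ext m : 1
      refine HomologicalComplex.mapBifunctor.hom_ext fun p q hpq => ?_
      rw [HomologicalComplex.add_f_apply, Preadditive.comp_add, ι_mapBifunctorMap,
        ι_mapBifunctorMap, ι_mapBifunctorMap, HomologicalComplex.add_f_apply, Functor.map_add,
        Preadditive.add_comp, Preadditive.comp_add]
    exact h

end HilbertTensor

end

/-! ### The Künneth formula -/

theorem theorem4 {C : Type u₁} [Category.{v₁} C] [HilbertCategory C]
    {C' : Type u₂} [Category.{v₂} C'] [HilbertCategory C']
    {C'' : Type u₃} [Category.{v₃} C''] [HilbertCategory C'']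
    (T : HilbertTensor C C' C'')
    (K : ChainComplex C ℕ) (hK : ∃ N, ∀ i, N < i → IsZero (K.X i))
    (L : ChainComplex C' ℕ) (hL : ∃ N, ∀ i, N < i → IsZero (L.X i)) (n : ℕ) :
    Nonempty (ExtCat.homology (T.complex K L) n ≅
      (⨁ fun p : {p : ℕ × ℕ // p.1 + p.2 = n} =>
        T.tensor (ExtCat.homology K p.1.1) (ExtCat.homology L p.1.2)) ⊞
      (⨁ fun p : {p : ℕ × ℕ // p.1 + p.2 + 1 = n} =>
        T.periodic (ExtCat.homology K p.1.1) (ExtCat.homology L p.1.2))) := by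
  obtain ⟨N, hK⟩ := hK
  obtain ⟨N', hL⟩ := hL
  -- all pairs of degrees with sum at most `n` have to occur among the indices of the strands
  obtain ⟨M, hN, hN', hn⟩ : ∃ M, N ≤ M ∧ N' ≤ M ∧ n ≤ M :=
    ⟨N + N' + n, by omega, by omega, by omega⟩
  obtain ⟨φ, ψ, h, hne, total⟩ := HilbertCategory.exists_strand_decomposition K
  obtain ⟨φ', ψ', h', hne', total'⟩ := HilbertCategory.exists_strand_decomposition L
  obtain ⟨p, q, hqp, hqp', hpq⟩ := exists_total_of_biadditive T.complexFunctor
    (fun i : Fin (M + 1) => φ i) (fun i => ψ i) (fun j : Fin (M + 1) => φ' j) (fun j => ψ' j)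
    (fun i => h i) (fun i i' hi => hne i i' (Fin.val_ne_of_ne hi))
    (total M fun i hi => hK i (by omega))
    (fun j => h' j) (fun j j' hj => hne' j j' (Fin.val_ne_of_ne hj))
    (total' M fun j hj => hL j (by omega))
  let H : ChainComplex C'' ℕ ⥤ ExtCat C'' :=
    (ExtCat.emb C'').mapHomologicalComplex (ComplexShape.down ℕ) ⋙
      HomologicalComplex.homologyFunctor (ExtCat C'') (ComplexShape.down ℕ) n
  have hH (D : ChainComplex C'' ℕ) : Nonempty (H.obj D ≅ ExtCat.homology D n) :=
    ExtCat.nonempty_homology_iso D n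
  have hA (a : {p : ℕ × ℕ // p.1 + p.2 = n}) :
      Nonempty (H.obj (T.complex (HilbertCategory.strand K a.1.1) (HilbertCategory.strand L a.1.2)) ≅
        T.tensor (ExtCat.homology K a.1.1) (ExtCat.homology L a.1.2)) := by
    obtain ⟨⟨i, j⟩, rfl⟩ := a
    obtain ⟨e⟩ := hH (T.complex (HilbertCategory.strand K i) (HilbertCategory.strand L j))
    obtain ⟨e'⟩ := T.nonempty_homology_double_bottom (ExtCat.homology K i).reduce.hom
      (ExtCat.homology L j).reduce.hom (i := i) (j := j) rfl rfl
    exact ⟨e ≪≫ e'⟩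
  have hB (b : {p : ℕ × ℕ // p.1 + p.2 + 1 = n}) :
      Nonempty (H.obj (T.complex (HilbertCategory.strand K b.1.1) (HilbertCategory.strand L b.1.2)) ≅
        T.periodic (ExtCat.homology K b.1.1) (ExtCat.homology L b.1.2)) := by
    obtain ⟨⟨i, j⟩, rfl⟩ := b
    obtain ⟨e⟩ := hH (T.complex (HilbertCategory.strand K i) (HilbertCategory.strand L j))
    obtain ⟨e'⟩ := T.nonempty_homology_double_middle (ExtCat.homology K i).reduce.hom
      (ExtCat.homology L j).reduce.hom (i := i) (j := j) rfl rfl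
    exact ⟨e ≪≫ e'⟩
  obtain ⟨e₀⟩ := hH (T.complex K L)
  obtain ⟨e⟩ := nonempty_iso_biprod_of_total (X := H.obj (T.complex K L))
    (fun s : Fin (M + 1) × Fin (M + 1) => H.obj (T.complex (HilbertCategory.strand K s.1) (HilbertCategory.strand L s.2)))
    (fun s => H.map (p s)) (fun s => H.map (q s))
    (fun s => (H.map_comp _ _).symm.trans ((congrArg H.map (hqp s)).trans (H.map_id _)))
    (fun s t hst => (H.map_comp _ _).symm.trans
      ((congrArg H.map (hqp' s t hst)).trans (H.map_zero _ _)))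
    (by
      refine Eq.trans ?_ ((congrArg H.map hpq).trans (H.map_id _))
      rw [H.map_sum]
      exact Finset.sum_congr rfl fun s _ => (H.map_comp _ _).symm)
    (fun a : {p : ℕ × ℕ // p.1 + p.2 = n} =>
      (⟨a.1.1, by have := a.2; omega⟩, ⟨a.1.2, by have := a.2; omega⟩))
    (fun b : {p : ℕ × ℕ // p.1 + p.2 + 1 = n} =>
      (⟨b.1.1, by have := b.2; omega⟩, ⟨b.1.2, by have := b.2; omega⟩))
    (fun a a' haa => by
      simp only [Prod.mk.injEq, Fin.mk.injEq] at haa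
      exact Subtype.ext (Prod.ext haa.1 haa.2))
    (fun b b' hbb => by
      simp only [Prod.mk.injEq, Fin.mk.injEq] at hbb
      exact Subtype.ext (Prod.ext hbb.1 hbb.2))
    (fun a b hab => by
      simp only [Prod.mk.injEq, Fin.mk.injEq] at hab
      have ha := a.2
      have hb := b.2
      omega)
    (fun a => (hA a).some) (fun b => (hB b).some)
    (fun s hsA hsB => by
      obtain ⟨e⟩ := hH (T.complex (HilbertCategory.strand K s.1) (HilbertCategory.strand L s.2))
      refine IsZero.of_iso (T.isZero_homology_double _ _ rfl rfl (ExtCat.reduce_injective _) n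
        (fun hs => ?_) (fun hs => ?_)) e
      · exact hsA ⟨(s.1, s.2), hs⟩ rfl
      · exact hsB ⟨(s.1, s.2), hs⟩ rfl)
  exact ⟨e₀.symm ≪≫ e⟩
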